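/- Let $\mathcal M$ be a distributive monoidal category, i.e. a monoidal category with all (set-indexed) coproducts in which $\otimes$ preserves coproducts in each variable. Let $\mathcal M$ act (on the left) on categories $\mathcal C$ and $\mathcal D$ that have all set-indexed coproducts; write the actions as $M \bullet X$ (for $X\in\mathcal C$) and $Y \bullet M$ (for $Y\in\mathcal D$, so that $Y\bullet(M\otimes N)\cong (Y\bullet N)\bullet M$). Assume that both actions preserve coproducts in $\mathcal M$, and that the action on $\mathcal C$ also preserves coproducts in $\mathcal C$: $M\bullet\sum_j X_j\cong\sum_j M\bullet X_j$. The coproduct completion of the category of mixed optics is the following category of set-indexed optics. An object is a triple $(I,X,X')$ of a set $I$, a family $(X_i)_{i\in I}$ of objects of $\mathcal C$ and a family $(X'_i)_{i\in I}$ of objects of $\mathcal D$. The morphisms $(I,X,X')\to(J,Y,Y')$ are the elements of the coend $$\int^{M\in[I\times J,\mathcal M]}\ \prod_{i\in I}\ \mathcal C\Bigl(X_i,\ \sum_{j\in J} M_i^j\bullet Y_j\Bigr)\times\mathcal D\Bigl(\sum_{j\in J} Y'_j\bullet M_i^j,\ X'_i\Bigr).$$ The residual of the identity is the identity matrix (the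 monoidal unit on the diagonal, the initial object elsewhere), and the residual of a composite is the matrix product $(MN)_i^k=\sum_j M_i^j\otimes N_j^k$. Suppose moreover that the actions have right adjoints, i.e. that $-\bullet X:\mathcal M\to\mathcal C$ for every $X\in\mathcal C$ and $Y\bullet -:\mathcal M\to\mathcal D$ for every $Y\in\mathcal D$ have right adjoints $[X,-]$ and $[Y,-]$, so that $\mathcal C$ and $\mathcal D$ are $\mathcal M$-enriched, with hom-objects $[-,-]$, composition $[Y,Z]\otimes[X,Y]\to[X,Z]$, and the action as tensor. A polynomial $\mathcal M$-functor $\mathcal D\to\mathcal C$ is an $\mathcal M$-functor isomorphic to one of the form $$F(Y)=\sum_{i\in I}[X'_i,Y]\bullet X_i$$ for a set $I$ and families $(X_i)_{i\in I}$ in $\mathcal C$ and $(X'_i)_{i\in I}$ in $\mathcal D$. Then the category of set-indexed optics is equivalent to the category of polynomial $\mathcal M$-functors $\mathcal D\to\mathcal C$ and $\mathcal M$-natural transformations, by an equivalence that sends $(I,X,X')$ to a functor isomorphic to $Y\mapsto\sum_{i\in I}[X'_i,Y]\bullet X_i$. -/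

import Mathlib

open CategoryTheory MonoidalCategory Limits
open scoped MonoidalLeftAction

universe w v₀ v₁ v₂ u₀ u₁ u₂

set_option linter.unusedSectionVars false

noncomputable section

namespace IndexedOptics

section Hypotheses

/-- A distributive monoidal category: all (`w`-small) coproducts exist, and the tensor product
preserves them in each variable. -/
class DistributiveMonoidal (M : Type u₀) [Category.{v₀} M] [MonoidalCategory M] : Prop where
  hasCoproducts : HasCoproducts.{w} M
  preserves_tensorLeft (A : M) (J : Type w) :
    PreservesColimitsOfShape (Discrete J) (tensorLeft A)
  preserves_tensorRight (A : M) (J : Type w) :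
    PreservesColimitsOfShape (Discrete J) (tensorRight A)

variable (M : Type u₀) [Category.{v₀} M] [MonoidalCategory M]
variable (C : Type u₁) [Category.{v₁} C] [MonoidalLeftAction M C]

/-- The action of `M` on `C` preserves (`w`-small) coproducts in `M`:
`(∑ j, A j) • X = ∑ j, A j • X`. -/
class PreservesCoproductsInScalar : Prop where
  preserves_actionRight (X : C) (J : Type w) :
    PreservesColimitsOfShape (Discrete J) (MonoidalLeftAction.actionRight M X)

/-- The action of `M` on `C` preserves (`w`-small) coproducts in `C`:
`A • (∑ j, X j) = ∑ j, A • X j`. -/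
class PreservesCoproductsInObject : Prop where
  preserves_actionLeft (A : M) (J : Type w) :
    PreservesColimitsOfShape (Discrete J) (MonoidalLeftAction.actionLeft C A)

/-- The action of `M` on `C` has right adjoints: each `- • X : M ⥤ C` has a right adjoint. -/
class ClosedAction : Prop where
  isLeftAdjoint (X : C) : (MonoidalLeftAction.actionRight M X).IsLeftAdjoint

end Hypotheses

attribute [instance] DistributiveMonoidal.preserves_tensorLeft
  DistributiveMonoidal.preserves_tensorRight
  PreservesCoproductsInScalar.preserves_actionRight
  PreservesCoproductsInObject.preserves_actionLeft
  ClosedAction.isLeftAdjoint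

section CoproductLemmas

variable {E : Type u₁} [Category.{v₁} E] {E' : Type u₂} [Category.{v₂} E']

/-- A morphism out of `F (∑ j, x j)`, for `F` preserving the coproduct, given on components. -/
def mapDesc (F : E ⥤ E') {J : Type w} [PreservesColimitsOfShape (Discrete J) F]
    (x : J → E) [HasCoproduct x] {Z : E'} (f : ∀ j, F.obj (x j) ⟶ Z) : F.obj (∐ x) ⟶ Z :=
  (isColimitCofanMkObjOfIsColimit F x _ (coproductIsCoproduct x)).desc (Cofan.mk Z f)

lemma map_ι_mapDesc (F : E ⥤ E') {J : Type w} [PreservesColimitsOfShape (Discrete J) F]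
    (x : J → E) [HasCoproduct x] {Z : E'} (f : ∀ j, F.obj (x j) ⟶ Z) (j : J) :
    F.map (Sigma.ι x j) ≫ mapDesc F x f = f j :=
  (isColimitCofanMkObjOfIsColimit F x _ (coproductIsCoproduct x)).fac (Cofan.mk Z f) ⟨j⟩

lemma mapDesc_ext (F : E ⥤ E') {J : Type w} [PreservesColimitsOfShape (Discrete J) F]
    (x : J → E) [HasCoproduct x] {Z : E'} {f g : F.obj (∐ x) ⟶ Z}
    (h : ∀ j, F.map (Sigma.ι x j) ≫ f = F.map (Sigma.ι x j) ≫ g) : f = g :=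
  Cofan.IsColimit.hom_ext (isColimitCofanMkObjOfIsColimit F x _ (coproductIsCoproduct x)) _ _ h

end CoproductLemmas

section Matrices

variable {M : Type u₀} [Category.{v₀} M] [MonoidalCategory M]
variable {C : Type u₁} [Category.{v₁} C] [MonoidalLeftAction M C]

instance [DistributiveMonoidal.{w} M] (J : Type w) : HasColimitsOfShape (Discrete J) M :=
  DistributiveMonoidal.hasCoproducts J

variable (M) in
lemma hasInitial_of_distributive [DistributiveMonoidal.{w} M] : HasInitial M :=
  hasColimitsOfShape_of_equivalence (Discrete.equivalence (Equiv.equivOfIsEmpty PEmpty.{w + 1} PEmpty.{1}))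

section Identity

variable [DistributiveMonoidal.{w} M]

open Classical in
variable (M) in
/-- The identity matrix: the monoidal unit on the diagonal, the initial object elsewhere. -/
def idMatrix {I : Type w} (i j : I) : M :=
  if i = j then 𝟙_ M else @initial M _ (hasInitial_of_distributive.{w} M)

/-- The identification of a diagonal entry of the identity matrix with the monoidal unit. -/
def unitToIdMatrix {I : Type w} {i j : I} (h : i = j) : 𝟙_ M ⟶ idMatrix M i j :=
  eqToHom (by simp [idMatrix, h])

/-- The off-diagonal entries of the identity matrix are sent to initial objects by any functor
that preserves coproducts. -/
def isInitialIdMatrix {I : Type w} {i j : I} (h : i ≠ j) {E : Type u₂} [Category.{v₂} E]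
    (F : M ⥤ E) [PreservesColimitsOfShape (Discrete PEmpty.{w + 1}) F] :
    IsInitial (F.obj (idMatrix M i j)) :=
  haveI := hasInitial_of_distributive.{w} M
  haveI : PreservesColimitsOfShape (Discrete PEmpty.{1}) F :=
    preservesColimitsOfShape_of_equiv (Discrete.equivalence (Equiv.equivOfIsEmpty PEmpty.{w + 1} PEmpty.{1})) F
  IsInitial.isInitialObj F _ (initialIsInitial.ofIso (eqToIso (by simp [idMatrix, h])))

open Classical in
/-- A morphism out of the image of an entry of the identity matrix, given on the diagonal. -/
def idMatrixDesc {I : Type w} {E : Type u₂} [Category.{v₂} E]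
    (F : M ⥤ E) [PreservesColimitsOfShape (Discrete PEmpty.{w + 1}) F] (i j : I) {Z : E}
    (f : i = j → (F.obj (𝟙_ M) ⟶ Z)) : F.obj (idMatrix M i j) ⟶ Z :=
  if h : i = j then F.map (eqToHom (by simp [idMatrix, h])) ≫ f h
  else (isInitialIdMatrix h F).to Z

lemma unitToIdMatrix_desc {I : Type w} {E : Type u₂} [Category.{v₂} E]
    (F : M ⥤ E) [PreservesColimitsOfShape (Discrete PEmpty.{w + 1}) F] {i j : I} {Z : E}
    (f : i = j → (F.obj (𝟙_ M) ⟶ Z)) (h : i = j) :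
    F.map (unitToIdMatrix h) ≫ idMatrixDesc F i j f = f h := by
  simp only [idMatrixDesc, dif_pos h, unitToIdMatrix, ← Category.assoc, ← F.map_comp]
  simp

lemma idMatrix_hom_ext {I : Type w} {E : Type u₂} [Category.{v₂} E]
    (F : M ⥤ E) [PreservesColimitsOfShape (Discrete PEmpty.{w + 1}) F] {i j : I} {Z : E}
    {f g : F.obj (idMatrix M i j) ⟶ Z}
    (H : ∀ h : i = j, F.map (unitToIdMatrix h) ≫ f = F.map (unitToIdMatrix h) ≫ g) : f = g := by
  by_cases h : i = j
  · have : IsIso (unitToIdMatrix (M := M) h) := by unfold unitToIdMatrix; infer_instance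
    exact (cancel_epi (F.map (unitToIdMatrix h))).1 (H h)
  · exact (isInitialIdMatrix h F).hom_ext f g

end Identity

variable {I J K L : Type w}

/-- The matrix product `(A B) i k = ∑ j, A i j ⊗ B j k`. -/
def matMul [DistributiveMonoidal.{w} M] (A : I → J → M) (B : J → K → M) (i : I) (k : K) : M :=
  ∐ fun j => A i j ⊗ B j k

section Action

variable [HasCoproducts.{w} C]

/-- The action of a matrix on a family of objects: `(A • Y) i = ∑ j, A i j • Y j`. -/
def matAct (A : I → J → M) (Y : J → C) (i : I) : C :=
  ∐ fun j => A i j ⊙ₗ Y j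

/-- The summand inclusion `A i j • Y j ⟶ ∑ j, A i j • Y j`. -/
def actι (A : I → J → M) (Y : J → C) (i : I) (j : J) : A i j ⊙ₗ Y j ⟶ matAct A Y i :=
  Sigma.ι (fun j => A i j ⊙ₗ Y j) j

/-- A morphism out of `∑ j, A i j • Y j`, given on summands. -/
def actDesc (A : I → J → M) (Y : J → C) (i : I) {Z : C} (f : ∀ j, A i j ⊙ₗ Y j ⟶ Z) :
    matAct A Y i ⟶ Z :=
  Sigma.desc f

@[simp]
lemma actι_desc (A : I → J → M) (Y : J → C) (i : I) {Z : C} (f : ∀ j, A i j ⊙ₗ Y j ⟶ Z) (j : J) :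
    actι A Y i j ≫ actDesc A Y i f = f j :=
  Sigma.ι_desc _ _

@[simp]
lemma actι_desc_assoc (A : I → J → M) (Y : J → C) (i : I) {Z : C} (f : ∀ j, A i j ⊙ₗ Y j ⟶ Z) (j : J)
    {T : _} (t : _ ⟶ T) :
    actι A Y i j ≫ actDesc A Y i f ≫ t =
      (f j) ≫ t := by
  simp only [← Category.assoc]; congr 1; simpa only [Category.assoc] using actι_desc A Y i f j

lemma act_hom_ext {A : I → J → M} {Y : J → C} {i : I} {Z : C} {f g : matAct A Y i ⟶ Z}
    (h : ∀ j, actι A Y i j ≫ f = actι A Y i j ≫ g) : f = g :=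
  Sigma.hom_ext _ _ h

/-- Functoriality of the matrix action in the matrix. -/
def actMapLeft {A B : I → J → M} (φ : ∀ i j, A i j ⟶ B i j) (Y : J → C) (i : I) :
    matAct A Y i ⟶ matAct B Y i :=
  actDesc A Y i fun j => φ i j ⊵ₗ Y j ≫ actι B Y i j

/-- Functoriality of the matrix action in the family of objects. -/
def actMapRight (A : I → J → M) {Y Z : J → C} (f : ∀ j, Y j ⟶ Z j) (i : I) :
    matAct A Y i ⟶ matAct A Z i :=
  actDesc A Y i fun j => A i j ⊴ₗ f j ≫ actι A Z i j

@[simp]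
lemma actι_mapLeft {A B : I → J → M} (φ : ∀ i j, A i j ⟶ B i j) (Y : J → C) (i : I) (j : J) :
    actι A Y i j ≫ actMapLeft φ Y i = φ i j ⊵ₗ Y j ≫ actι B Y i j := by
  simp [actMapLeft]

@[simp]
lemma actι_mapLeft_assoc {A B : I → J → M} (φ : ∀ i j, A i j ⟶ B i j) (Y : J → C) (i : I) (j : J)
    {T : _} (t : _ ⟶ T) :
    actι A Y i j ≫ actMapLeft φ Y i ≫ t =
      (φ i j ⊵ₗ Y j ≫ actι B Y i j) ≫ t := by
  simp only [← Category.assoc]; congr 1; simpa only [Category.assoc] using actι_mapLeft φ Y i j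

lemma actMapLeft_id (A : I → J → M) (Y : J → C) (i : I) :
    actMapLeft (fun i j => 𝟙 (A i j)) Y i = 𝟙 _ :=
  act_hom_ext fun j => by simp

@[simp]
lemma actι_mapRight (A : I → J → M) {Y Z : J → C} (f : ∀ j, Y j ⟶ Z j) (i : I) (j : J) :
    actι A Y i j ≫ actMapRight A f i = A i j ⊴ₗ f j ≫ actι A Z i j := by
  simp [actMapRight]

@[simp]
lemma actι_mapRight_assoc (A : I → J → M) {Y Z : J → C} (f : ∀ j, Y j ⟶ Z j) (i : I) (j : J)
    {T : _} (t : _ ⟶ T) :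
    actι A Y i j ≫ actMapRight A f i ≫ t =
      (A i j ⊴ₗ f j ≫ actι A Z i j) ≫ t := by
  simp only [← Category.assoc]; congr 1; simpa only [Category.assoc] using actι_mapRight A f i j

lemma actMapRight_id (A : I → J → M) (Y : J → C) (i : I) :
    actMapRight A (fun j => 𝟙 (Y j)) i = 𝟙 _ :=
  act_hom_ext fun j => by simp

lemma actMapRight_comp (A : I → J → M) {X Y Z : J → C} (f : ∀ j, X j ⟶ Y j) (g : ∀ j, Y j ⟶ Z j)
    (i : I) : actMapRight A (fun j => f j ≫ g j) i = actMapRight A f i ≫ actMapRight A g i :=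
  act_hom_ext fun j => by simp

lemma actMap_exchange {A B : I → J → M} (φ : ∀ i j, A i j ⟶ B i j) {Y Z : J → C}
    (f : ∀ j, Y j ⟶ Z j) (i : I) :
    actMapLeft φ Y i ≫ actMapRight B f i = actMapRight A f i ≫ actMapLeft φ Z i :=
  act_hom_ext fun j => by
    simp [← MonoidalLeftAction.action_exchange_assoc]

end Action

section Mul

variable [DistributiveMonoidal.{w} M]

/-- The summand inclusion `A i j ⊗ B j k ⟶ ∑ j, A i j ⊗ B j k`. -/
def mulι (A : I → J → M) (B : J → K → M) (i : I) (j : J) (k : K) :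
    A i j ⊗ B j k ⟶ matMul A B i k :=
  Sigma.ι (fun j => A i j ⊗ B j k) j

/-- A morphism out of `∑ j, A i j ⊗ B j k`, given on summands. -/
def mulDesc (A : I → J → M) (B : J → K → M) (i : I) (k : K) {Z : M}
    (f : ∀ j, A i j ⊗ B j k ⟶ Z) : matMul A B i k ⟶ Z :=
  Sigma.desc f

@[simp]
lemma mulι_desc (A : I → J → M) (B : J → K → M) (i : I) (k : K) {Z : M}
    (f : ∀ j, A i j ⊗ B j k ⟶ Z) (j : J) : mulι A B i j k ≫ mulDesc A B i k f = f j :=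
  Sigma.ι_desc _ _

@[simp]
lemma mulι_desc_assoc (A : I → J → M) (B : J → K → M) (i : I) (k : K) {Z : M}
    (f : ∀ j, A i j ⊗ B j k ⟶ Z) (j : J)
    {T : _} (t : _ ⟶ T) :
    mulι A B i j k ≫ mulDesc A B i k f ≫ t =
      (f j) ≫ t := by
  simp only [← Category.assoc]; congr 1; simpa only [Category.assoc] using mulι_desc A B i k f j

/-- Functoriality of the matrix product. -/
def mulMap {A A' : I → J → M} {B B' : J → K → M} (φ : ∀ i j, A i j ⟶ A' i j)
    (ψ : ∀ j k, B j k ⟶ B' j k) (i : I) (k : K) : matMul A B i k ⟶ matMul A' B' i k :=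
  mulDesc A B i k fun j => (φ i j ⊗ₘ ψ j k) ≫ mulι A' B' i j k

@[simp]
lemma mulι_map {A A' : I → J → M} {B B' : J → K → M} (φ : ∀ i j, A i j ⟶ A' i j)
    (ψ : ∀ j k, B j k ⟶ B' j k) (i : I) (j : J) (k : K) :
    mulι A B i j k ≫ mulMap φ ψ i k = (φ i j ⊗ₘ ψ j k) ≫ mulι A' B' i j k := by
  simp [mulMap]

@[simp]
lemma mulι_map_assoc {A A' : I → J → M} {B B' : J → K → M} (φ : ∀ i j, A i j ⟶ A' i j)
    (ψ : ∀ j k, B j k ⟶ B' j k) (i : I) (j : J) (k : K)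
    {T : _} (t : _ ⟶ T) :
    mulι A B i j k ≫ mulMap φ ψ i k ≫ t =
      ((φ i j ⊗ₘ ψ j k) ≫ mulι A' B' i j k) ≫ t := by
  simp only [← Category.assoc]; congr 1; simpa only [Category.assoc] using mulι_map φ ψ i j k

/-- A morphism out of `(∑ j, A i j ⊗ B j k) ⊗ P`, given on summands. -/
def mulTensorDesc (A : I → J → M) (B : J → K → M) (i : I) (k : K) (P : M) {Z : M}
    (f : ∀ j, (A i j ⊗ B j k) ⊗ P ⟶ Z) : matMul A B i k ⊗ P ⟶ Z :=
  mapDesc (tensorRight P) _ f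

@[simp]
lemma mulι_tensorDesc (A : I → J → M) (B : J → K → M) (i : I) (k : K) (P : M) {Z : M}
    (f : ∀ j, (A i j ⊗ B j k) ⊗ P ⟶ Z) (j : J) :
    mulι A B i j k ▷ P ≫ mulTensorDesc A B i k P f = f j :=
  map_ι_mapDesc (tensorRight P) _ f j

@[simp]
lemma mulι_tensorDesc_assoc (A : I → J → M) (B : J → K → M) (i : I) (k : K) (P : M) {Z : M}
    (f : ∀ j, (A i j ⊗ B j k) ⊗ P ⟶ Z) (j : J)
    {T : _} (t : _ ⟶ T) :
    mulι A B i j k ▷ P ≫ mulTensorDesc A B i k P f ≫ t =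
      (f j) ≫ t := by
  simp only [← Category.assoc]; congr 1; simpa only [Category.assoc] using mulι_tensorDesc A B i k P f j

/-- The associativity comparison `(A B) N ⟶ A (B N)` of matrix products. -/
def mulAssoc (A : I → J → M) (B : J → K → M) (N : K → L → M) (i : I) (l : L) :
    matMul (matMul A B) N i l ⟶ matMul A (matMul B N) i l :=
  mulDesc _ _ i l fun k => mulTensorDesc A B i k (N k l) fun j =>
    (α_ _ _ _).hom ≫ A i j ◁ mulι B N j k l ≫ mulι A (matMul B N) i j l

@[simp]
lemma mulι_assoc (A : I → J → M) (B : J → K → M) (N : K → L → M)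
    (i : I) (j : J) (k : K) (l : L) :
    mulι A B i j k ▷ N k l ≫ mulι (matMul A B) N i k l ≫ mulAssoc A B N i l =
      (α_ _ _ _).hom ≫ A i j ◁ mulι B N j k l ≫ mulι A (matMul B N) i j l := by
  simp [mulAssoc]

@[simp]
lemma mulι_assoc_assoc (A : I → J → M) (B : J → K → M) (N : K → L → M)
    (i : I) (j : J) (k : K) (l : L)
    {T : _} (t : _ ⟶ T) :
    mulι A B i j k ▷ N k l ≫ mulι (matMul A B) N i k l ≫ mulAssoc A B N i l ≫ t =
      ((α_ _ _ _).hom ≫ A i j ◁ mulι B N j k l ≫ mulι A (matMul B N) i j l) ≫ t := by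
  simp only [← Category.assoc]; congr 1; simpa only [Category.assoc] using mulι_assoc A B N i j k l

/-- The left unitality comparison `1 A ⟶ A` of matrix products. -/
def mulLeftUnit (A : I → J → M) (i : I) (j : J) : matMul (idMatrix M) A i j ⟶ A i j :=
  mulDesc _ _ i j fun i' => idMatrixDesc (tensorRight (A i' j)) i i' fun h =>
    (λ_ (A i' j)).hom ≫ eqToHom (by rw [h])

@[simp]
lemma mulι_leftUnit (A : I → J → M) (i i' : I) (h : i = i') (j : J) :
    unitToIdMatrix h ▷ A i' j ≫ mulι (idMatrix M) A i i' j ≫ mulLeftUnit A i j =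
      (λ_ (A i' j)).hom ≫ eqToHom (by rw [h]) := by
  simp only [mulLeftUnit, mulι_desc]
  exact unitToIdMatrix_desc (tensorRight (A i' j)) _ h

@[simp]
lemma mulι_leftUnit_assoc (A : I → J → M) (i i' : I) (h : i = i') (j : J)
    {T : _} (t : _ ⟶ T) :
    unitToIdMatrix h ▷ A i' j ≫ mulι (idMatrix M) A i i' j ≫ mulLeftUnit A i j ≫ t =
      ((λ_ (A i' j)).hom ≫ eqToHom (by rw [h])) ≫ t := by
  simp only [← Category.assoc]; congr 1; simpa only [Category.assoc] using mulι_leftUnit A i i' h j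

/-- The right unitality comparison `A 1 ⟶ A` of matrix products. -/
def mulRightUnit (A : I → J → M) (i : I) (j : J) : matMul A (idMatrix M) i j ⟶ A i j :=
  mulDesc _ _ i j fun j' => idMatrixDesc (tensorLeft (A i j')) j' j fun h =>
    (ρ_ (A i j')).hom ≫ eqToHom (by rw [h])

@[simp]
lemma mulι_rightUnit (A : I → J → M) (i : I) (j' j : J) (h : j' = j) :
    A i j' ◁ unitToIdMatrix h ≫ mulι A (idMatrix M) i j' j ≫ mulRightUnit A i j =
      (ρ_ (A i j')).hom ≫ eqToHom (by rw [h]) := by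
  simp only [mulRightUnit, mulι_desc]
  exact unitToIdMatrix_desc (tensorLeft (A i j')) _ h

@[simp]
lemma mulι_rightUnit_assoc (A : I → J → M) (i : I) (j' j : J) (h : j' = j)
    {T : _} (t : _ ⟶ T) :
    A i j' ◁ unitToIdMatrix h ≫ mulι A (idMatrix M) i j' j ≫ mulRightUnit A i j ≫ t =
      ((ρ_ (A i j')).hom ≫ eqToHom (by rw [h])) ≫ t := by
  simp only [← Category.assoc]; congr 1; simpa only [Category.assoc] using mulι_rightUnit A i j' j h

section Scalar

variable [PreservesCoproductsInScalar.{w} M C]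

/-- A morphism out of `(∑ j, A i j ⊗ B j k) • Y`, given on summands. -/
def mulActDesc (A : I → J → M) (B : J → K → M) (i : I) (k : K) (Y : C) {Z : C}
    (f : ∀ j, (A i j ⊗ B j k) ⊙ₗ Y ⟶ Z) : matMul A B i k ⊙ₗ Y ⟶ Z :=
  mapDesc (MonoidalLeftAction.actionRight M Y) _ f

@[simp]
lemma mulι_actDesc (A : I → J → M) (B : J → K → M) (i : I) (k : K) (Y : C) {Z : C}
    (f : ∀ j, (A i j ⊗ B j k) ⊙ₗ Y ⟶ Z) (j : J) :
    mulι A B i j k ⊵ₗ Y ≫ mulActDesc A B i k Y f = f j :=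
  map_ι_mapDesc (MonoidalLeftAction.actionRight M Y) _ f j

@[simp]
lemma mulι_actDesc_assoc (A : I → J → M) (B : J → K → M) (i : I) (k : K) (Y : C) {Z : C}
    (f : ∀ j, (A i j ⊗ B j k) ⊙ₗ Y ⟶ Z) (j : J)
    {T : _} (t : _ ⟶ T) :
    mulι A B i j k ⊵ₗ Y ≫ mulActDesc A B i k Y f ≫ t =
      (f j) ≫ t := by
  simp only [← Category.assoc]; congr 1; simpa only [Category.assoc] using mulι_actDesc A B i k Y f j

lemma mulAct_hom_ext {A : I → J → M} {B : J → K → M} {i : I} {k : K} {Y Z : C}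
    {f g : matMul A B i k ⊙ₗ Y ⟶ Z}
    (h : ∀ j, mulι A B i j k ⊵ₗ Y ≫ f = mulι A B i j k ⊵ₗ Y ≫ g) : f = g :=
  mapDesc_ext (MonoidalLeftAction.actionRight M Y) _ h

/-- A morphism out of the action of an entry of the identity matrix, given on the diagonal. -/
def idActDesc (i j : I) (Y : C) {Z : C} (f : i = j → (𝟙_ M ⊙ₗ Y ⟶ Z)) :
    idMatrix M i j ⊙ₗ Y ⟶ Z :=
  idMatrixDesc (MonoidalLeftAction.actionRight M Y) i j f

@[simp]
lemma unit_idActDesc (i j : I) (Y : C) {Z : C} (f : i = j → (𝟙_ M ⊙ₗ Y ⟶ Z)) (h : i = j) :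
    unitToIdMatrix h ⊵ₗ Y ≫ idActDesc i j Y f = f h :=
  unitToIdMatrix_desc (MonoidalLeftAction.actionRight M Y) f h

@[simp]
lemma unit_idActDesc_assoc (i j : I) (Y : C) {Z : C} (f : i = j → (𝟙_ M ⊙ₗ Y ⟶ Z)) (h : i = j)
    {T : _} (t : _ ⟶ T) :
    unitToIdMatrix h ⊵ₗ Y ≫ idActDesc i j Y f ≫ t =
      (f h) ≫ t := by
  simp only [← Category.assoc]; congr 1; simpa only [Category.assoc] using unit_idActDesc i j Y f h

lemma idAct_hom_ext {i j : I} {Y Z : C} {f g : idMatrix M i j ⊙ₗ Y ⟶ Z}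
    (H : ∀ h : i = j, unitToIdMatrix h ⊵ₗ Y ≫ f = unitToIdMatrix h ⊵ₗ Y ≫ g) : f = g :=
  idMatrix_hom_ext (MonoidalLeftAction.actionRight M Y) H

variable [HasCoproducts.{w} C]

/-- The comparison `(A B) • Y ⟶ A • (B • Y)`. -/
def actUnmul (A : I → J → M) (B : J → K → M) (Y : K → C) (i : I) :
    matAct (matMul A B) Y i ⟶ matAct A (matAct B Y) i :=
  actDesc _ _ i fun k => mulActDesc A B i k (Y k) fun j =>
    (αₗ (A i j) (B j k) (Y k)).hom ≫ A i j ⊴ₗ actι B Y j k ≫ actι A (matAct B Y) i j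

@[simp]
lemma mulι_actUnmul (A : I → J → M) (B : J → K → M) (Y : K → C) (i : I) (j : J) (k : K) :
    mulι A B i j k ⊵ₗ Y k ≫ actι (matMul A B) Y i k ≫ actUnmul A B Y i =
      (αₗ (A i j) (B j k) (Y k)).hom ≫ A i j ⊴ₗ actι B Y j k ≫ actι A (matAct B Y) i j := by
  simp [actUnmul]

@[simp]
lemma mulι_actUnmul_assoc (A : I → J → M) (B : J → K → M) (Y : K → C) (i : I) (j : J) (k : K)
    {T : _} (t : _ ⟶ T) :
    mulι A B i j k ⊵ₗ Y k ≫ actι (matMul A B) Y i k ≫ actUnmul A B Y i ≫ t =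
      ((αₗ (A i j) (B j k) (Y k)).hom ≫ A i j ⊴ₗ actι B Y j k ≫ actι A (matAct B Y) i j) ≫ t := by
  simp only [← Category.assoc]; congr 1; simpa only [Category.assoc] using mulι_actUnmul A B Y i j k

variable (M) in
/-- The comparison `1 • Y ⟶ Y`. -/
def actIdDesc (Y : I → C) (i : I) : matAct (idMatrix M) Y i ⟶ Y i :=
  actDesc _ _ i fun j => idActDesc i j (Y j) fun h =>
    (λₗ (Y j)).hom ≫ eqToHom (by rw [h])

@[simp]
lemma unit_actIdDesc (Y : I → C) (i j : I) (h : i = j) :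
    unitToIdMatrix h ⊵ₗ Y j ≫ actι (idMatrix M) Y i j ≫ actIdDesc M Y i =
      (λₗ (Y j)).hom ≫ eqToHom (by rw [h]) := by
  simp [actIdDesc]

@[simp]
lemma unit_actIdDesc_assoc (Y : I → C) (i j : I) (h : i = j)
    {T : _} (t : _ ⟶ T) :
    unitToIdMatrix h ⊵ₗ Y j ≫ actι (idMatrix M) Y i j ≫ actIdDesc M Y i ≫ t =
      ((λₗ (Y j)).hom ≫ eqToHom (by rw [h])) ≫ t := by
  simp only [← Category.assoc]; congr 1; simpa only [Category.assoc] using unit_actIdDesc Y i j h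

end Scalar

variable (M) in
/-- The comparison `Y ⟶ 1 • Y`. -/
def actIdι [HasCoproducts.{w} C] (Y : I → C) (i : I) : Y i ⟶ matAct (idMatrix M) Y i :=
  (λₗ (Y i)).inv ≫ unitToIdMatrix rfl ⊵ₗ Y i ≫ actι (idMatrix M) Y i i

end Mul

section Object

variable [HasCoproducts.{w} C] [PreservesCoproductsInObject.{w} M C]

/-- A morphism out of `P • ∑ j, A i j • Y j`, given on summands. -/
def actActDesc (P : M) (A : I → J → M) (Y : J → C) (i : I) {Z : C}
    (f : ∀ j, P ⊙ₗ A i j ⊙ₗ Y j ⟶ Z) : P ⊙ₗ matAct A Y i ⟶ Z :=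
  mapDesc (MonoidalLeftAction.actionLeft C P) _ f

@[simp]
lemma actι_actDesc (P : M) (A : I → J → M) (Y : J → C) (i : I) {Z : C}
    (f : ∀ j, P ⊙ₗ A i j ⊙ₗ Y j ⟶ Z) (j : J) :
    P ⊴ₗ actι A Y i j ≫ actActDesc P A Y i f = f j :=
  map_ι_mapDesc (MonoidalLeftAction.actionLeft C P) _ f j

@[simp]
lemma actι_actDesc_assoc (P : M) (A : I → J → M) (Y : J → C) (i : I) {Z : C}
    (f : ∀ j, P ⊙ₗ A i j ⊙ₗ Y j ⟶ Z) (j : J)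
    {T : _} (t : _ ⟶ T) :
    P ⊴ₗ actι A Y i j ≫ actActDesc P A Y i f ≫ t =
      (f j) ≫ t := by
  simp only [← Category.assoc]; congr 1; simpa only [Category.assoc] using actι_actDesc P A Y i f j

lemma actAct_hom_ext {P : M} {A : I → J → M} {Y : J → C} {i : I} {Z : C}
    {f g : P ⊙ₗ matAct A Y i ⟶ Z}
    (h : ∀ j, P ⊴ₗ actι A Y i j ≫ f = P ⊴ₗ actι A Y i j ≫ g) : f = g :=
  mapDesc_ext (MonoidalLeftAction.actionLeft C P) _ h

/-- The comparison `A • (B • Y) ⟶ (A B) • Y`. -/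
def actMul [DistributiveMonoidal.{w} M] (A : I → J → M) (B : J → K → M) (Y : K → C) (i : I) :
    matAct A (matAct B Y) i ⟶ matAct (matMul A B) Y i :=
  actDesc _ _ i fun j => actActDesc (A i j) B Y j fun k =>
    (αₗ (A i j) (B j k) (Y k)).inv ≫ mulι A B i j k ⊵ₗ Y k ≫ actι (matMul A B) Y i k

@[simp]
lemma actι_actMul [DistributiveMonoidal.{w} M] (A : I → J → M) (B : J → K → M) (Y : K → C)
    (i : I) (j : J) (k : K) :
    A i j ⊴ₗ actι B Y j k ≫ actι A (matAct B Y) i j ≫ actMul A B Y i =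
      (αₗ (A i j) (B j k) (Y k)).inv ≫ mulι A B i j k ⊵ₗ Y k ≫ actι (matMul A B) Y i k := by
  simp [actMul]

@[simp]
lemma actι_actMul_assoc [DistributiveMonoidal.{w} M] (A : I → J → M) (B : J → K → M) (Y : K → C)
    (i : I) (j : J) (k : K)
    {T : _} (t : _ ⟶ T) :
    A i j ⊴ₗ actι B Y j k ≫ actι A (matAct B Y) i j ≫ actMul A B Y i ≫ t =
      ((αₗ (A i j) (B j k) (Y k)).inv ≫ mulι A B i j k ⊵ₗ Y k ≫ actι (matMul A B) Y i k) ≫ t := by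
  simp only [← Category.assoc]; congr 1; simpa only [Category.assoc] using actι_actMul A B Y i j k

end Object

section Laws

lemma tensor_act {P P' Q Q' : M} (f : P ⟶ P') (g : Q ⟶ Q') (Y : C) :
    (f ⊗ₘ g) ⊵ₗ Y = (αₗ P Q Y).hom ≫ P ⊴ₗ g ⊵ₗ Y ≫ f ⊵ₗ (Q' ⊙ₗ Y) ≫ (αₗ P' Q' Y).inv := by
  simp [tensorHom_def']

variable [DistributiveMonoidal.{w} M]

lemma mulι_map_act {A A' : I → J → M} {B B' : J → K → M} (φ : ∀ i j, A i j ⟶ A' i j)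
    (ψ : ∀ j k, B j k ⟶ B' j k) (i : I) (j : J) (k : K) (Y : C) {Z : C}
    (t : matMul A' B' i k ⊙ₗ Y ⟶ Z) :
    mulι A B i j k ⊵ₗ Y ≫ mulMap φ ψ i k ⊵ₗ Y ≫ t =
      (φ i j ⊗ₘ ψ j k) ⊵ₗ Y ≫ mulι A' B' i j k ⊵ₗ Y ≫ t := by
  simp only [← MonoidalLeftAction.comp_actionHomLeft_assoc, mulι_map]

lemma mulι_assoc_act (A : I → J → M) (B : J → K → M) (N : K → L → M)
    (i : I) (j : J) (k : K) (l : L) (Y : C) {Z : C}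
    (t : matMul A (matMul B N) i l ⊙ₗ Y ⟶ Z) :
    (mulι A B i j k ▷ N k l) ⊵ₗ Y ≫ mulι (matMul A B) N i k l ⊵ₗ Y ≫ mulAssoc A B N i l ⊵ₗ Y ≫ t =
      (α_ _ _ _).hom ⊵ₗ Y ≫ (A i j ◁ mulι B N j k l) ⊵ₗ Y ≫
        mulι A (matMul B N) i j l ⊵ₗ Y ≫ t := by
  simp only [← MonoidalLeftAction.comp_actionHomLeft_assoc, mulι_assoc]

lemma mulι_leftUnit_act (A : I → J → M) (i : I) (j : J) (Y : C) {Z : C} (t : A i j ⊙ₗ Y ⟶ Z) :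
    (unitToIdMatrix rfl ▷ A i j) ⊵ₗ Y ≫ mulι (idMatrix M) A i i j ⊵ₗ Y ≫ mulLeftUnit A i j ⊵ₗ Y ≫ t =
      (λ_ (A i j)).hom ⊵ₗ Y ≫ t := by
  simp only [← MonoidalLeftAction.comp_actionHomLeft_assoc, mulι_leftUnit, eqToHom_refl,
    Category.comp_id]

lemma mulι_rightUnit_act (A : I → J → M) (i : I) (j : J) (Y : C) {Z : C} (t : A i j ⊙ₗ Y ⟶ Z) :
    (A i j ◁ unitToIdMatrix rfl) ⊵ₗ Y ≫ mulι A (idMatrix M) i j j ⊵ₗ Y ≫ mulRightUnit A i j ⊵ₗ Y ≫ t =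
      (ρ_ (A i j)).hom ⊵ₗ Y ≫ t := by
  simp only [← MonoidalLeftAction.comp_actionHomLeft_assoc, mulι_rightUnit, eqToHom_refl,
    Category.comp_id]

variable [HasCoproducts.{w} C]

section

variable [PreservesCoproductsInObject.{w} M C]

lemma actMul_naturality {A A' : I → J → M} {B B' : J → K → M} (φ : ∀ i j, A i j ⟶ A' i j)
    (ψ : ∀ j k, B j k ⟶ B' j k) (Y : K → C) (i : I) :
    actMul A B Y i ≫ actMapLeft (mulMap φ ψ) Y i =
      actMapRight A (actMapLeft ψ Y) i ≫ actMapLeft φ (matAct B' Y) i ≫ actMul A' B' Y i := by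
  refine act_hom_ext fun j => actAct_hom_ext fun k => ?_
  simp only [actι_actMul_assoc, Category.assoc, actι_mapLeft, mulι_map_act, tensor_act,
    actι_mapRight_assoc, actι_mapLeft_assoc]
  rw [← MonoidalLeftAction.actionHomRight_comp_assoc, actι_mapLeft,
    MonoidalLeftAction.actionHomRight_comp_assoc,
    MonoidalLeftAction.action_exchange_assoc (φ i j) (actι B' Y j k), actι_actMul]
  simp

lemma actMul_naturality_right (A : I → J → M) (B : J → K → M) {Y Z : K → C}
    (f : ∀ k, Y k ⟶ Z k) (i : I) :
    actMapRight A (actMapRight B f) i ≫ actMul A B Z i =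
      actMul A B Y i ≫ actMapRight (matMul A B) f i := by
  refine act_hom_ext fun j => actAct_hom_ext fun k => ?_
  simp only [actι_actMul_assoc, Category.assoc, actι_mapRight, actι_mapRight_assoc]
  rw [← MonoidalLeftAction.actionHomRight_comp_assoc, actι_mapRight,
    MonoidalLeftAction.actionHomRight_comp_assoc, actι_actMul,
    ← MonoidalLeftAction.action_exchange_assoc]
  simp

lemma actMul_assoc (A : I → J → M) (B : J → K → M) (N : K → L → M) (Y : L → C) (i : I) :
    actMul A B (matAct N Y) i ≫ actMul (matMul A B) N Y i ≫ actMapLeft (mulAssoc A B N) Y i =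
      actMapRight A (actMul B N Y) i ≫ actMul A (matMul B N) Y i := by
  refine act_hom_ext fun j => actAct_hom_ext fun k => ?_
  simp only [actι_actMul_assoc, Category.assoc, actι_mapRight_assoc]
  rw [← cancel_epi (αₗ (A i j) (B j k) (matAct N Y k)).hom]
  refine actAct_hom_ext fun l => ?_
  have e : A i j ⊴ₗ B j k ⊴ₗ actι N Y k l ≫ A i j ⊴ₗ actι B (matAct N Y) j k ≫
      A i j ⊴ₗ actMul B N Y j = A i j ⊴ₗ (αₗ (B j k) (N k l) (Y l)).inv ≫
        A i j ⊴ₗ mulι B N j k l ⊵ₗ Y l ≫ A i j ⊴ₗ actι (matMul B N) Y j l := by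
    simp only [← MonoidalLeftAction.actionHomRight_comp, actι_actMul]
  have e' : (A i j ⊗ B j k) ⊴ₗ actι N Y k l ≫ (αₗ (A i j) (B j k) (matAct N Y k)).hom =
      (αₗ (A i j) (B j k) (N k l ⊙ₗ Y l)).hom ≫ A i j ⊴ₗ B j k ⊴ₗ actι N Y k l := by
    simp
  rw [Iso.hom_inv_id_assoc, reassoc_of% e', reassoc_of% e, actι_actMul,
    MonoidalLeftAction.action_exchange_assoc, actι_actMul_assoc]
  simp only [Category.assoc, actι_mapLeft, MonoidalLeftAction.actionHomLeft_action,
    Iso.hom_inv_id_assoc, mulι_assoc_act, MonoidalLeftAction.whiskerLeft_actionHomLeft]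
  rw [← cancel_epi (αₗ (A i j ⊗ B j k) (N k l) (Y l)).hom, Iso.hom_inv_id_assoc,
    ← MonoidalLeftAction.associator_actionHom_assoc,
    MonoidalLeftAction.actionHomRight_hom_inv_assoc]

lemma actIdι_mul (A : I → J → M) (Y : J → C) (i : I) :
    actIdι M (matAct A Y) i ≫ actMul (idMatrix M) A Y i ≫ actMapLeft (mulLeftUnit A) Y i =
      𝟙 _ := by
  refine act_hom_ext fun j => ?_
  simp only [actIdι, Category.assoc, Category.comp_id]
  rw [← MonoidalLeftAction.actionUnitIso_inv_naturality_assoc,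
    MonoidalLeftAction.action_exchange_assoc, actι_actMul_assoc, Category.assoc, Category.assoc,
    actι_mapLeft, MonoidalLeftAction.actionHomLeft_action]
  simp only [Category.assoc, Iso.hom_inv_id_assoc, mulι_leftUnit_act]
  simp

lemma actMul_idι (A : I → J → M) (Y : J → C) (i : I) :
    actMapRight A (actIdι M Y) i ≫ actMul A (idMatrix M) Y i ≫ actMapLeft (mulRightUnit A) Y i =
      𝟙 _ := by
  refine act_hom_ext fun j => ?_
  simp only [actIdι, actι_mapRight_assoc, Category.assoc, Category.comp_id,
    MonoidalLeftAction.actionHomRight_comp, actι_actMul_assoc, actι_mapLeft]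
  have := mulι_rightUnit_act A i j (Y j) (actι A Y i j)
  simp only [MonoidalLeftAction.whiskerLeft_actionHomLeft,
    MonoidalLeftAction.rightUnitor_actionHom, Category.assoc, cancel_epi] at this
  rw [this, MonoidalLeftAction.actionHomRight_inv_hom_assoc]

end

lemma actIdι_naturality {Y Z : I → C} (f : ∀ i, Y i ⟶ Z i) (i : I) :
    f i ≫ actIdι M Z i = actIdι M Y i ≫ actMapRight (idMatrix M) f i := by
  simp only [actIdι, Category.assoc, actι_mapRight]
  rw [← MonoidalLeftAction.action_exchange_assoc,
    MonoidalLeftAction.actionUnitIso_inv_naturality_assoc]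

variable [PreservesCoproductsInScalar.{w} M C]

lemma actUnmul_naturality {A A' : I → J → M} {B B' : J → K → M} (φ : ∀ i j, A i j ⟶ A' i j)
    (ψ : ∀ j k, B j k ⟶ B' j k) (Y : K → C) (i : I) :
    actMapLeft (mulMap φ ψ) Y i ≫ actUnmul A' B' Y i =
      actUnmul A B Y i ≫ actMapRight A (actMapLeft ψ Y) i ≫ actMapLeft φ (matAct B' Y) i := by
  refine act_hom_ext fun k => mulAct_hom_ext fun j => ?_
  simp only [actι_mapLeft_assoc, Category.assoc, mulι_map_act, mulι_actUnmul, tensor_act,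
    mulι_actUnmul_assoc, actι_mapRight_assoc, actι_mapLeft]
  rw [← MonoidalLeftAction.actionHomRight_comp_assoc, actι_mapLeft,
    MonoidalLeftAction.actionHomRight_comp_assoc,
    MonoidalLeftAction.action_exchange_assoc (φ i j) (actι B' Y j k)]
  simp

lemma actUnmul_naturality_right (A : I → J → M) (B : J → K → M) {Y Z : K → C}
    (f : ∀ k, Y k ⟶ Z k) (i : I) :
    actUnmul A B Y i ≫ actMapRight A (actMapRight B f) i =
      actMapRight (matMul A B) f i ≫ actUnmul A B Z i := by
  refine act_hom_ext fun k => mulAct_hom_ext fun j => ?_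
  simp only [mulι_actUnmul_assoc, Category.assoc, actι_mapRight, actι_mapRight_assoc]
  rw [← MonoidalLeftAction.actionHomRight_comp_assoc, actι_mapRight,
    MonoidalLeftAction.actionHomRight_comp_assoc, ← MonoidalLeftAction.action_exchange_assoc,
    mulι_actUnmul]
  simp

lemma actUnmul_assoc (A : I → J → M) (B : J → K → M) (N : K → L → M) (Y : L → C) (i : I) :
    actMapLeft (mulAssoc A B N) Y i ≫ actUnmul A (matMul B N) Y i ≫
        actMapRight A (actUnmul B N Y) i =
      actUnmul (matMul A B) N Y i ≫ actUnmul A B (matAct N Y) i := by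
  refine act_hom_ext fun l => mulAct_hom_ext fun k => ?_
  rw [← cancel_epi (αₗ (matMul A B i k) (N k l) (Y l)).inv]
  refine mulAct_hom_ext fun j => ?_
  have e : A i j ⊴ₗ mulι B N j k l ⊵ₗ Y l ≫ A i j ⊴ₗ actι (matMul B N) Y j l ≫
      A i j ⊴ₗ actUnmul B N Y j = A i j ⊴ₗ (αₗ (B j k) (N k l) (Y l)).hom ≫
        A i j ⊴ₗ B j k ⊴ₗ actι N Y k l ≫ A i j ⊴ₗ actι B (matAct N Y) j k := by
    simp only [← MonoidalLeftAction.actionHomRight_comp, mulι_actUnmul]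
  simp only [actι_mapLeft_assoc, Category.assoc, mulι_actUnmul_assoc,
    MonoidalLeftAction.actionHomLeft_action, Iso.hom_inv_id_assoc, mulι_assoc_act,
    MonoidalLeftAction.whiskerLeft_actionHomLeft, Iso.inv_hom_id_assoc, actι_mapRight]
  rw [reassoc_of% e, MonoidalLeftAction.associator_actionHom_assoc, Iso.inv_hom_id_assoc,
    ← MonoidalLeftAction.actionHomLeft_action_assoc,
    ← MonoidalLeftAction.action_exchange_assoc, mulι_actUnmul]
  simp

lemma actUnmul_idDesc (A : I → J → M) (Y : J → C) (i : I) :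
    actUnmul (idMatrix M) A Y i ≫ actIdDesc M (matAct A Y) i =
      actMapLeft (mulLeftUnit A) Y i := by
  refine act_hom_ext fun j => mulAct_hom_ext fun i' => ?_
  rw [← cancel_epi (αₗ (idMatrix M i i') (A i' j) (Y j)).inv]
  refine idAct_hom_ext fun h => ?_
  subst h
  simp only [mulι_actUnmul_assoc, actι_mapLeft, Category.assoc, Iso.inv_hom_id_assoc,
    MonoidalLeftAction.actionHomLeft_action, Iso.hom_inv_id_assoc, mulι_leftUnit_act]
  rw [← MonoidalLeftAction.actionHomLeft_action_assoc,
    ← MonoidalLeftAction.action_exchange_assoc, unit_actIdDesc]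
  simp

lemma actUnmul_mapIdDesc (A : I → J → M) (Y : J → C) (i : I) :
    actUnmul A (idMatrix M) Y i ≫ actMapRight A (actIdDesc M Y) i =
      actMapLeft (mulRightUnit A) Y i := by
  refine act_hom_ext fun j => mulAct_hom_ext fun j' => ?_
  refine idMatrix_hom_ext (tensorLeft (A i j') ⋙ MonoidalLeftAction.actionRight M (Y j))
    fun h => ?_
  subst h
  change (A i j' ◁ unitToIdMatrix rfl) ⊵ₗ Y j' ≫ _ = (A i j' ◁ unitToIdMatrix rfl) ⊵ₗ Y j' ≫ _
  have e : A i j' ⊴ₗ unitToIdMatrix (M := M) rfl ⊵ₗ Y j' ≫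
      A i j' ⊴ₗ actι (idMatrix M) Y j' j' ≫ A i j' ⊴ₗ actIdDesc M Y j' =
        A i j' ⊴ₗ (λₗ (Y j')).hom := by
    simp [← MonoidalLeftAction.actionHomRight_comp]
  rw [actι_mapLeft, mulι_rightUnit_act]
  simp only [mulι_actUnmul_assoc, Category.assoc,
    actι_mapRight, MonoidalLeftAction.whiskerLeft_actionHomLeft, Iso.inv_hom_id_assoc,
    MonoidalLeftAction.rightUnitor_actionHom]
  rw [reassoc_of% e]

lemma actIdDesc_naturality {Y Z : I → C} (f : ∀ i, Y i ⟶ Z i) (i : I) :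
    actIdDesc M Y i ≫ f i = actMapRight (idMatrix M) f i ≫ actIdDesc M Z i := by
  refine act_hom_ext fun j => idAct_hom_ext fun h => ?_
  subst h
  simp only [unit_actIdDesc_assoc, actι_mapRight_assoc, Category.assoc]
  rw [← MonoidalLeftAction.action_exchange_assoc, unit_actIdDesc]
  simp

end Laws

end Matrices

section Optics

/-- An object of the category of set-indexed optics: a set-indexed family of pairs
`(X i, X' i)` of an object of `C` and an object of `D`. (The monoidal category `M` of residuals
only enters in the morphisms.) -/
structure IndexedOptic (M : Type u₀) (C : Type u₁) (D : Type u₂) where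
  /-- The indexing set `I`. -/
  index : Type w
  /-- The family `X : I → C`. -/
  fst : index → C
  /-- The family `X' : I → D`. -/
  snd : index → D

variable {M : Type u₀} [Category.{v₀} M] [MonoidalCategory M]
variable {C : Type u₁} [Category.{v₁} C] [MonoidalLeftAction M C]
variable {D : Type u₂} [Category.{v₂} D] [MonoidalLeftAction M D]

/-- A representative of an optic `(I, X, X') ⟶ (J, Y, Y')`: a residual matrix `A : I × J → M`,
a family of morphisms `X i ⟶ ∑ j, A i j • Y j` in `C`, and a family of morphisms
`∑ j, A i j • Y' j ⟶ X' i` in `D`. -/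
structure PreOptic [HasCoproducts.{w} C] [HasCoproducts.{w} D]
    (X Y : IndexedOptic.{w} M C D) where
  /-- The residual matrix. -/
  res : X.index → Y.index → M
  /-- The forward components. -/
  fwd (i : X.index) : X.fst i ⟶ matAct res Y.fst i
  /-- The backward components. -/
  bwd (i : X.index) : matAct res Y.snd i ⟶ X.snd i

namespace PreOptic

variable [HasCoproducts.{w} C] [HasCoproducts.{w} D]

/-- The relation generating the coend over residual matrices `A : I × J → M`: for a morphism
`φ : A ⟶ B` of matrices, `(A, f, φ ≫ g)` is identified with `(B, f ≫ φ, g)`. -/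
def Slide {X Y : IndexedOptic.{w} M C D} (p q : PreOptic X Y) : Prop :=
  ∃ φ : ∀ i j, p.res i j ⟶ q.res i j,
    (∀ i, q.fwd i = p.fwd i ≫ actMapLeft φ Y.fst i) ∧
    (∀ i, p.bwd i = actMapLeft φ Y.snd i ≫ q.bwd i)

variable [DistributiveMonoidal.{w} M]
variable [PreservesCoproductsInObject.{w} M C] [PreservesCoproductsInScalar.{w} M D]

/-- The identity optic, with residual the identity matrix. -/
def id (X : IndexedOptic.{w} M C D) : PreOptic X X where
  res := idMatrix M
  fwd := actIdι M X.fst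
  bwd := actIdDesc M X.snd

/-- Composition of optics, with residual the matrix product. -/
def comp {X Y Z : IndexedOptic.{w} M C D} (p : PreOptic X Y) (q : PreOptic Y Z) :
    PreOptic X Z where
  res := matMul p.res q.res
  fwd i := p.fwd i ≫ actMapRight p.res q.fwd i ≫ actMul p.res q.res Z.fst i
  bwd i := actUnmul p.res q.res Z.snd i ≫ actMapRight p.res q.bwd i ≫ p.bwd i

lemma slide_comp_left {X Y Z : IndexedOptic.{w} M C D} {p p' : PreOptic X Y} (h : Slide p p')
    (q : PreOptic Y Z) : Slide (p.comp q) (p'.comp q) := by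
  obtain ⟨φ, h₁, h₂⟩ := h
  refine ⟨mulMap φ fun _ _ => 𝟙 _, fun i => ?_, fun i => ?_⟩
  · simp only [comp, Category.assoc, actMul_naturality, h₁,
      reassoc_of% (actMap_exchange φ q.fwd i)]
    rw [funext fun j => actMapLeft_id q.res Z.fst j, actMapRight_id, Category.id_comp]
  · simp only [comp, h₂, reassoc_of% (actUnmul_naturality φ),
      reassoc_of% (actMap_exchange φ q.bwd i)]
    rw [funext fun j => actMapLeft_id q.res Z.snd j, actMapRight_id, Category.id_comp]

lemma slide_comp_right {X Y Z : IndexedOptic.{w} M C D} (p : PreOptic X Y) {q q' : PreOptic Y Z}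
    (h : Slide q q') : Slide (p.comp q) (p.comp q') := by
  obtain ⟨φ, h₁, h₂⟩ := h
  refine ⟨mulMap (fun _ _ => 𝟙 _) φ, fun i => ?_, fun i => ?_⟩
  · simp only [comp, Category.assoc, actMul_naturality, funext h₁, actMapLeft_id, Category.id_comp,
      actMapRight_comp]
  · simp only [comp, funext h₂, actMapRight_comp, Category.assoc]
    rw [reassoc_of% (actUnmul_naturality (fun i j => 𝟙 (p.res i j)) φ), actMapLeft_id,
      Category.id_comp]

lemma slide_id_comp {X Y : IndexedOptic.{w} M C D} (p : PreOptic X Y) :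
    Slide ((id X).comp p) p := by
  refine ⟨mulLeftUnit p.res, fun i => ?_, fun i => ?_⟩
  · simp only [comp, id, Category.assoc]
    rw [← reassoc_of% (actIdι_naturality p.fwd i), actIdι_mul, Category.comp_id]
  · simp only [comp, id]
    rw [← actIdDesc_naturality, reassoc_of% (actUnmul_idDesc p.res Y.snd i)]

lemma slide_comp_id {X Y : IndexedOptic.{w} M C D} (p : PreOptic X Y) :
    Slide (p.comp (id Y)) p := by
  refine ⟨mulRightUnit p.res, fun i => ?_, fun i => ?_⟩
  · simp only [comp, id, Category.assoc]
    rw [actMul_idι, Category.comp_id]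
  · simp only [comp, id]
    rw [reassoc_of% (actUnmul_mapIdDesc p.res Y.snd i)]

lemma slide_assoc {W X Y Z : IndexedOptic.{w} M C D} (p : PreOptic W X) (q : PreOptic X Y)
    (r : PreOptic Y Z) : Slide ((p.comp q).comp r) (p.comp (q.comp r)) := by
  refine ⟨mulAssoc p.res q.res r.res, fun i => ?_, fun i => ?_⟩
  · simp only [comp, Category.assoc, actMapRight_comp]
    rw [← actMul_assoc, reassoc_of% (actMul_naturality_right p.res q.res r.fwd i)]
  · simp only [comp, Category.assoc, actMapRight_comp]
    rw [reassoc_of% (actUnmul_assoc p.res q.res r.res Z.snd i),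
      reassoc_of% (actUnmul_naturality_right p.res q.res r.bwd i)]

end PreOptic

variable [HasCoproducts.{w} C] [HasCoproducts.{w} D] [DistributiveMonoidal.{w} M]
variable [PreservesCoproductsInObject.{w} M C] [PreservesCoproductsInScalar.{w} M D]

/-- The category of set-indexed optics. Its hom-sets are the coends
`∫^{A : I × J → M} ∏ i, C(X i, ∑ j, A i j • Y j) × D(∑ j, A i j • Y' j, X' i)`. -/
instance : Category.{max w u₀ v₁ v₂} (IndexedOptic.{w} M C D) where
  Hom X Y := Quot (PreOptic.Slide (X := X) (Y := Y))
  id X := Quot.mk _ (PreOptic.id X)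
  comp f g := Quot.map₂ PreOptic.comp (fun p _ _ h => PreOptic.slide_comp_right p h)
    (fun _ _ q h => PreOptic.slide_comp_left h q) f g
  id_comp := by
    rintro X Y ⟨p⟩
    exact Quot.sound p.slide_id_comp
  comp_id := by
    rintro X Y ⟨p⟩
    exact Quot.sound p.slide_comp_id
  assoc := by
    rintro W X Y Z ⟨p⟩ ⟨q⟩ ⟨r⟩
    exact Quot.sound (p.slide_assoc q r)

end Optics

section Enrichment

variable (M : Type u₀) [Category.{v₀} M] [MonoidalCategory M]
variable {C : Type u₁} [Category.{v₁} C] [MonoidalLeftAction M C] [ClosedAction M C]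

/-- The hom-object `[X, Y]` in `M` determined by the action: `[X, -]` is right adjoint to
`- • X : M ⥤ C`. -/
def homObj (X Y : C) : M :=
  (MonoidalLeftAction.actionRight M X).rightAdjoint.obj Y

variable {M}

/-- The tensor adjunction `C(A • X, Y) ≃ M(A, [X, Y])`. -/
def tensorHomEquiv (A : M) (X Y : C) : (A ⊙ₗ X ⟶ Y) ≃ (A ⟶ homObj M X Y) :=
  (Adjunction.ofIsLeftAdjoint (MonoidalLeftAction.actionRight M X)).homEquiv A Y

lemma tensorHomEquiv_symm_comp {A B : M} {X Y : C} (f : A ⟶ B) (g : B ⟶ homObj M X Y) :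
    (tensorHomEquiv A X Y).symm (f ≫ g) = f ⊵ₗ X ≫ (tensorHomEquiv B X Y).symm g :=
  (Adjunction.ofIsLeftAdjoint (MonoidalLeftAction.actionRight M X)).homEquiv_naturality_left_symm f g

variable (M) in
/-- The evaluation `[X, Y] • X ⟶ Y`. -/
def homEval (X Y : C) : homObj M X Y ⊙ₗ X ⟶ Y :=
  (tensorHomEquiv (homObj M X Y) X Y).symm (𝟙 _)

lemma tensorHomEquiv_symm_eq {A : M} {X Y : C} (f : A ⟶ homObj M X Y) :
    (tensorHomEquiv A X Y).symm f = f ⊵ₗ X ≫ homEval M X Y := by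
  rw [homEval, ← tensorHomEquiv_symm_comp, Category.comp_id]

lemma tensorHomEquiv_act_homEval {A : M} {X Y : C} (f : A ⊙ₗ X ⟶ Y) :
    tensorHomEquiv A X Y f ⊵ₗ X ≫ homEval M X Y = f := by
  rw [← tensorHomEquiv_symm_eq, Equiv.symm_apply_apply]

lemma tensorHomEquiv_act_homEval_assoc {A : M} {X Y Z : C} (f : A ⊙ₗ X ⟶ Y) (t : Y ⟶ Z) :
    tensorHomEquiv A X Y f ⊵ₗ X ≫ homEval M X Y ≫ t = f ≫ t := by
  rw [← Category.assoc, tensorHomEquiv_act_homEval]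

lemma homObj_hom_ext {A : M} {X Y : C} {f g : A ⟶ homObj M X Y}
    (h : f ⊵ₗ X ≫ homEval M X Y = g ⊵ₗ X ≫ homEval M X Y) : f = g := by
  rwa [← tensorHomEquiv_symm_eq, ← tensorHomEquiv_symm_eq, EmbeddingLike.apply_eq_iff_eq] at h

variable (M) in
/-- The unit `1 ⟶ [X, X]`. -/
def homUnit (X : C) : 𝟙_ M ⟶ homObj M X X :=
  tensorHomEquiv _ _ _ (λₗ X).hom

variable (M) in
/-- The composition `[Y, Z] ⊗ [X, Y] ⟶ [X, Z]`. -/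
def homComp (X Y Z : C) : homObj M Y Z ⊗ homObj M X Y ⟶ homObj M X Z :=
  tensorHomEquiv _ _ _ ((αₗ _ _ _).hom ≫ homObj M Y Z ⊴ₗ homEval M X Y ≫ homEval M Y Z)

lemma homUnit_eval (X : C) : homUnit M X ⊵ₗ X ≫ homEval M X X = (λₗ X).hom :=
  tensorHomEquiv_act_homEval _

lemma homComp_eval (X Y Z : C) : homComp M X Y Z ⊵ₗ X ≫ homEval M X Z =
    (αₗ _ _ _).hom ≫ homObj M Y Z ⊴ₗ homEval M X Y ≫ homEval M Y Z :=
  tensorHomEquiv_act_homEval _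

lemma homUnit_comp (X Y : C) :
    homObj M X Y ◁ homUnit M X ≫ homComp M X X Y = (ρ_ _).hom := by
  refine homObj_hom_ext ?_
  simp only [MonoidalLeftAction.comp_actionHomLeft, Category.assoc, homComp_eval,
    MonoidalLeftAction.whiskerLeft_actionHomLeft, Iso.inv_hom_id_assoc,
    MonoidalLeftAction.rightUnitor_actionHom]
  rw [← MonoidalLeftAction.actionHomRight_comp_assoc, homUnit_eval]

lemma homComp_unit (X Y : C) :
    homUnit M Y ▷ homObj M X Y ≫ homComp M X Y Y = (λ_ _).hom := by
  refine homObj_hom_ext ?_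
  simp only [MonoidalLeftAction.comp_actionHomLeft, Category.assoc, homComp_eval,
    MonoidalLeftAction.whiskerRight_actionHomLeft, Iso.inv_hom_id_assoc,
    MonoidalLeftAction.leftUnitor_actionHom]
  rw [← MonoidalLeftAction.action_exchange_assoc, homUnit_eval,
    MonoidalLeftAction.actionUnitIso_hom_naturality]

lemma homComp_assoc (W X Y Z : C) :
    homComp M X Y Z ▷ homObj M W X ≫ homComp M W X Z =
      (α_ _ _ _).hom ≫ homObj M Y Z ◁ homComp M W X Y ≫ homComp M W Y Z := by
  refine homObj_hom_ext ?_
  simp only [MonoidalLeftAction.comp_actionHomLeft, Category.assoc, homComp_eval,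
    MonoidalLeftAction.whiskerRight_actionHomLeft, Iso.inv_hom_id_assoc,
    MonoidalLeftAction.whiskerLeft_actionHomLeft]
  rw [← MonoidalLeftAction.action_exchange_assoc, homComp_eval,
    ← MonoidalLeftAction.actionHomRight_comp_assoc, homComp_eval]
  simp

/-- The morphism `1 ⟶ [X, Y]` that corresponds to a morphism `X ⟶ Y` of `C`. -/
def homName {X Y : C} (f : X ⟶ Y) : 𝟙_ M ⟶ homObj M X Y :=
  tensorHomEquiv (𝟙_ M) X Y ((λₗ X).hom ≫ f)

lemma homName_eval {X Y : C} (f : X ⟶ Y) :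
    homName (M := M) f ⊵ₗ X ≫ homEval M X Y = (λₗ X).hom ≫ f :=
  tensorHomEquiv_act_homEval _

lemma homName_id (X : C) : homName (M := M) (𝟙 X) = homUnit M X := by
  simp [homName, homUnit]

lemma homName_comp {X Y Z : C} (f : X ⟶ Y) (g : Y ⟶ Z) :
    homName (M := M) (f ≫ g) =
      (ρ_ (𝟙_ M)).inv ≫ (homName g ⊗ₘ homName f) ≫ homComp M X Y Z := by
  refine homObj_hom_ext ?_
  rw [← cancel_epi ((ρ_ (𝟙_ M)).hom ⊵ₗ X)]
  simp only [MonoidalLeftAction.comp_actionHomLeft, Category.assoc, homComp_eval, homName_eval,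
    tensor_act, Iso.inv_hom_id_assoc, MonoidalLeftAction.hom_inv_actionHomLeft_assoc]
  rw [← MonoidalLeftAction.action_exchange_assoc, homName_eval,
    ← MonoidalLeftAction.actionHomRight_comp_assoc, homName_eval]
  simp

/-- The `M`-enriched structure on `C` whose tensor is the action of `M`. Composition is
`[Y, Z] ⊗ [X, Y] ⟶ [X, Z]`; as Mathlib writes composition in enriched categories in the
diagrammatic order, this is an enrichment in the monoidal opposite of `M` in Mathlib's convention. -/
instance : EnrichedOrdinaryCategory Mᴹᵒᵖ C where
  Hom X Y := .mop (homObj M X Y)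
  id X := (homUnit M X).mop
  comp X Y Z := (homComp M X Y Z).mop
  id_comp X Y := by
    apply MonoidalOpposite.hom_ext
    change (ρ_ (homObj M X Y)).inv ≫ homObj M X Y ◁ homUnit M X ≫ homComp M X X Y = 𝟙 _
    rw [homUnit_comp, Iso.inv_hom_id]
  comp_id X Y := by
    apply MonoidalOpposite.hom_ext
    change (λ_ (homObj M X Y)).inv ≫ homUnit M Y ▷ homObj M X Y ≫ homComp M X Y Y = 𝟙 _
    rw [homComp_unit, Iso.inv_hom_id]
  assoc W X Y Z := by
    apply MonoidalOpposite.hom_ext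
    change (α_ _ _ _).hom ≫ homObj M Y Z ◁ homComp M W X Y ≫ homComp M W Y Z =
      homComp M X Y Z ▷ homObj M W X ≫ homComp M W X Z
    rw [homComp_assoc]
  homEquiv {X Y} :=
    { toFun f := (homName f).mop
      invFun g := (λₗ X).inv ≫ (tensorHomEquiv (𝟙_ M) X Y).symm g.unmop
      left_inv f := by simp [homName]
      right_inv g := by
        apply MonoidalOpposite.hom_ext
        simp [homName] }
  homEquiv_id X := congrArg Quiver.Hom.mop (homName_id X)
  homEquiv_comp f g := congrArg Quiver.Hom.mop (homName_comp f g)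

end Enrichment

section EnrichedFunctors

variable (V : Type u₀) [Category.{v₀} V] [MonoidalCategory V]
variable (D : Type u₂) [EnrichedCategory V D]
variable (C : Type u₁) [Category.{v₁} C] [EnrichedOrdinaryCategory V C]

/-- `V`-functors `D ⟶ C`, as the objects of a category whose morphisms are the `V`-natural
transformations. (Mathlib's category structure on `EnrichedFunctor V D C` only asks for naturality
of the underlying ordinary functors, which is weaker.) -/
structure VFunctor extends EnrichedFunctor V D C

variable {V D C}

/-- A `V`-natural transformation: components `F X ⟶ G X` such that the two morphisms
`[X, Y] ⟶ [F X, G Y]` in `V` agree. -/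
structure VNatTrans (F G : VFunctor V D C) where
  /-- The components. -/
  app (X : D) : F.obj X ⟶ G.obj X
  naturality (X Y : D) :
    F.map X Y ≫ eHomWhiskerLeft V (F.obj X) (app Y) =
      G.map X Y ≫ eHomWhiskerRight V (app X) (G.obj Y)

instance : Category (VFunctor V D C) where
  Hom F G := VNatTrans F G
  id F :=
    { app X := 𝟙 (F.obj X)
      naturality X Y := by simp }
  comp {F G H} σ τ :=
    { app X := σ.app X ≫ τ.app X
      naturality X Y := by
        rw [eHomWhiskerLeft_comp, ← Category.assoc, σ.naturality, Category.assoc,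
          ← eHom_whisker_exchange, ← Category.assoc, τ.naturality, eHomWhiskerRight_comp,
          Category.assoc] }
  id_comp σ := by cases σ; simp
  comp_id σ := by cases σ; simp
  assoc σ τ ρ := by simp

end EnrichedFunctors

section Polynomial

variable {M : Type u₀} [Category.{v₀} M] [MonoidalCategory M]
variable {C : Type u₁} [Category.{v₁} C] [MonoidalLeftAction M C] [ClosedAction M C]
variable {D : Type u₂} [Category.{v₂} D] [MonoidalLeftAction M D] [ClosedAction M D]
variable [HasCoproducts.{w} C]

/-- The object part `Y ↦ ∑ i, [X' i, Y] • X i` of a polynomial functor. -/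
def polyObj {I : Type w} (X : I → C) (X' : I → D) (Y : D) : C :=
  ∐ fun i => homObj M (X' i) Y ⊙ₗ X i

variable {I : Type w} (X : I → C) (X' : I → D)

variable (M) in
/-- The summand inclusion `[X' i, Y] • X i ⟶ ∑ i, [X' i, Y] • X i`. -/
def polyι (Y : D) (i : I) : homObj M (X' i) Y ⊙ₗ X i ⟶ polyObj (M := M) X X' Y :=
  Sigma.ι (fun i => homObj M (X' i) Y ⊙ₗ X i) i

variable [PreservesCoproductsInObject.{w} M C]

/-- A morphism out of `P • ∑ i, [X' i, Y] • X i`, given on summands. -/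
def actPolyDesc (P : M) (Y : D) {Z : C} (f : ∀ i, P ⊙ₗ homObj M (X' i) Y ⊙ₗ X i ⟶ Z) :
    P ⊙ₗ polyObj (M := M) X X' Y ⟶ Z :=
  mapDesc (MonoidalLeftAction.actionLeft C P) _ f

lemma polyι_actDesc (P : M) (Y : D) {Z : C} (f : ∀ i, P ⊙ₗ homObj M (X' i) Y ⊙ₗ X i ⟶ Z)
    (i : I) : P ⊴ₗ polyι M X X' Y i ≫ actPolyDesc X X' P Y f = f i :=
  map_ι_mapDesc (MonoidalLeftAction.actionLeft C P) _ f i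

variable {X X'} in
lemma actPoly_hom_ext {P : M} {Y : D} {Z : C} {f g : P ⊙ₗ polyObj (M := M) X X' Y ⟶ Z}
    (h : ∀ i, P ⊴ₗ polyι M X X' Y i ≫ f = P ⊴ₗ polyι M X X' Y i ≫ g) : f = g :=
  mapDesc_ext (MonoidalLeftAction.actionLeft C P) _ h

variable (M) in
/-- The action `[Y, Z] • ∑ i, [X' i, Y] • X i ⟶ ∑ i, [X' i, Z] • X i` of a polynomial functor on
morphisms, given on each summand by composition `[Y, Z] ⊗ [X' i, Y] ⟶ [X' i, Z]`. -/
def polyAct (Y Z : D) :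
    homObj M Y Z ⊙ₗ polyObj (M := M) X X' Y ⟶ polyObj (M := M) X X' Z :=
  actPolyDesc X X' _ Y fun i =>
    (αₗ _ _ _).inv ≫ homComp M (X' i) Y Z ⊵ₗ X i ≫ polyι M X X' Z i

lemma polyι_act (Y Z : D) (i : I) :
    homObj M Y Z ⊴ₗ polyι M X X' Y i ≫ polyAct M X X' Y Z =
      (αₗ _ _ _).inv ≫ homComp M (X' i) Y Z ⊵ₗ X i ≫ polyι M X X' Z i :=
  polyι_actDesc ..

lemma polyAct_unit (Y : D) :
    homUnit M Y ⊵ₗ polyObj (M := M) X X' Y ≫ polyAct M X X' Y Y = (λₗ _).hom := by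
  refine actPoly_hom_ext fun i => ?_
  rw [MonoidalLeftAction.action_exchange_assoc, polyι_act,
    MonoidalLeftAction.actionHomLeft_action_assoc, Iso.hom_inv_id_assoc,
    ← MonoidalLeftAction.comp_actionHomLeft_assoc, homComp_unit]
  simp

lemma polyAct_comp (W Y Z : D) :
    homComp M W Y Z ⊵ₗ polyObj (M := M) X X' W ≫ polyAct M X X' W Z =
      (αₗ _ _ _).hom ≫ homObj M Y Z ⊴ₗ polyAct M X X' W Y ≫ polyAct M X X' Y Z := by
  refine actPoly_hom_ext fun i => ?_
  rw [MonoidalLeftAction.action_exchange_assoc, polyι_act,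
    MonoidalLeftAction.actionHomLeft_action_assoc, Iso.hom_inv_id_assoc,
    ← MonoidalLeftAction.comp_actionHomLeft_assoc, homComp_assoc]
  simp only [MonoidalLeftAction.tensor_actionHomRight, Category.assoc, Iso.inv_hom_id_assoc]
  rw [← MonoidalLeftAction.actionHomRight_comp_assoc, polyι_act]
  simp only [MonoidalLeftAction.actionHomRight_comp, Category.assoc, polyι_act,
    MonoidalLeftAction.comp_actionHomLeft, MonoidalLeftAction.whiskerLeft_actionHomLeft]
  rw [← cancel_epi (αₗ (homObj M Y Z ⊗ homObj M W Y) (homObj M (X' i) W) (X i)).hom,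
    Iso.hom_inv_id_assoc, ← MonoidalLeftAction.associator_actionHom_assoc,
    MonoidalLeftAction.actionHomRight_hom_inv_assoc]

/-- The polynomial `M`-functor `Y ↦ ∑ i, [X' i, Y] • X i`, the coproduct of tensors of
representable `M`-functors. -/
def polyFunctor : VFunctor Mᴹᵒᵖ D C where
  obj Y := polyObj (M := M) X X' Y
  map Y Z := (tensorHomEquiv (homObj M Y Z) _ _ (polyAct M X X' Y Z)).mop
  map_id Y := by
    apply MonoidalOpposite.hom_ext
    refine homObj_hom_ext ?_
    change (homUnit M Y ≫ tensorHomEquiv _ _ _ (polyAct M X X' Y Y)) ⊵ₗ _ ≫ homEval M _ _ =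
      homUnit M _ ⊵ₗ _ ≫ homEval M _ _
    rw [MonoidalLeftAction.comp_actionHomLeft_assoc, tensorHomEquiv_act_homEval, polyAct_unit,
      homUnit_eval]
  map_comp W Y Z := by
    apply MonoidalOpposite.hom_ext
    refine homObj_hom_ext ?_
    change (homComp M W Y Z ≫ tensorHomEquiv _ _ _ (polyAct M X X' W Z)) ⊵ₗ _ ≫ homEval M _ _ =
      ((tensorHomEquiv _ _ _ (polyAct M X X' Y Z) ⊗ₘ tensorHomEquiv _ _ _ (polyAct M X X' W Y)) ≫
        homComp M _ _ _) ⊵ₗ _ ≫ homEval M _ _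
    rw [MonoidalLeftAction.comp_actionHomLeft_assoc, tensorHomEquiv_act_homEval, polyAct_comp,
      MonoidalLeftAction.comp_actionHomLeft_assoc, homComp_eval, tensor_act]
    simp only [Category.assoc, Iso.inv_hom_id_assoc]
    rw [← MonoidalLeftAction.action_exchange_assoc, tensorHomEquiv_act_homEval,
      ← MonoidalLeftAction.actionHomRight_comp_assoc, tensorHomEquiv_act_homEval]

variable (M C D) in
/-- An `M`-functor `F : D ⟶ C` is polynomial if it is isomorphic to
`Y ↦ ∑ i, [X' i, Y] • X i` for some set-indexed families `X i` in `C` and `X' i` in `D`. -/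
def isPolynomial : ObjectProperty (VFunctor Mᴹᵒᵖ D C) := fun F =>
  ∃ (I : Type w) (X : I → C) (X' : I → D), Nonempty (F ≅ polyFunctor (M := M) X X')

variable (M C D) in
/-- The category of polynomial `M`-functors `D ⟶ C` and `M`-natural transformations. -/
abbrev PolynomialFunctor := (isPolynomial.{w} M C D).FullSubcategory

end Polynomial

end IndexedOptics

end

/-!
Both sides have the same hom-sets, namely families of morphisms
`X i ⟶ ∑ j, [Y' j, X' i] • Y j` indexed by `i : I`.

* On the side of optics, the backward part `∑ j, A i j • Y' j ⟶ X' i` of an optic with residual `A`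
  is the same as a morphism of matrices `A i j ⟶ [Y' j, X' i]` (`matTranspose`). Sliding along it
  turns the optic into one with residual `[Y' j, X' i]` and with evaluation as backward part
  (`PreOptic.slide_ofPoints`), so that only its forward part is left. Conversely this forward part
  (`PreOptic.points`) depends only on the class of the optic in the coend
  (`PreOptic.Slide.points_eq`).
* On the side of polynomial functors, the enriched Yoneda lemma, applied on each summand of
  `F = ∑ i, [X' i, -] • X i`, says that an `M`-natural transformation `F ⟶ G` is determined by the
  images `X i ⟶ G (X' i)` of the generic elements, which are given by the units
  `1 ⟶ [X' i, X' i]`, and that these images are arbitrary (`polyNatTrans_ext`, `polyNatTrans`,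
  `polyUnit_natTrans`). For `G = ∑ j, [Y' j, -] • Y j` this gives the families above. Naturality is
  handled through the actions `[Y, Z] • F Y ⟶ F Z` (`naturality_iff_act`).

The two bijections are compatible with identities and composition (`PreOptic.points_id`,
`PreOptic.points_comp`); for composition the point is that the transpose of a composite of backward
parts, restricted to a summand of the matrix product, is the tensor product of the transposes
followed by the composition of hom-objects (`mulι_matTranspose`). This gives a fully faithful
functor from optics to `M`-functors (`opticToPoly`), whose essential image consists of the
polynomial functors by definition.
-/

noncomputable section

namespace IndexedOptics

/-! ### Enriched whiskering in terms of evaluation -/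

section HomObjects

variable {M : Type u₀} [Category.{v₀} M] [MonoidalCategory M]
variable {C : Type u₁} [Category.{v₁} C] [MonoidalLeftAction M C] [ClosedAction M C]

/-- Postcomposition `[X, Y] ⟶ [X, Z]` with `g`, characterized by its transpose. -/
lemma eHomWhiskerLeft_eval (X : C) {Y Z : C} (g : Y ⟶ Z) :
    (eHomWhiskerLeft Mᴹᵒᵖ X g).unmop ⊵ₗ X ≫ homEval M X Z = homEval M X Y ≫ g := by
  change ((λ_ _).inv ≫ homName g ▷ homObj M X Y ≫ homComp M X Y Z) ⊵ₗ X ≫ _ = _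
  simp only [MonoidalLeftAction.comp_actionHomLeft, Category.assoc, homComp_eval,
    MonoidalLeftAction.whiskerRight_actionHomLeft, Iso.inv_hom_id_assoc]
  rw [← MonoidalLeftAction.action_exchange_assoc, homName_eval,
    ← MonoidalLeftAction.actionUnitIso_hom_naturality_assoc,
    ← MonoidalLeftAction.leftUnitor_actionHom_assoc,
    MonoidalLeftAction.inv_hom_actionHomLeft_assoc]

/-- Precomposition `[Y, Z] ⟶ [X, Z]` with `f`, characterized by its transpose. -/
lemma eHomWhiskerRight_eval {X Y : C} (f : X ⟶ Y) (Z : C) :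
    (eHomWhiskerRight Mᴹᵒᵖ f Z).unmop ⊵ₗ X ≫ homEval M X Z =
      homObj M Y Z ⊴ₗ f ≫ homEval M Y Z := by
  change ((ρ_ _).inv ≫ homObj M Y Z ◁ homName f ≫ homComp M X Y Z) ⊵ₗ X ≫ _ = _
  simp only [MonoidalLeftAction.comp_actionHomLeft, Category.assoc, homComp_eval,
    MonoidalLeftAction.whiskerLeft_actionHomLeft, Iso.inv_hom_id_assoc]
  rw [← MonoidalLeftAction.actionHomRight_comp_assoc, homName_eval]
  have h := MonoidalLeftAction.rightUnitor_actionHom (homObj M Y Z) X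
  rw [MonoidalLeftAction.actionHomRight_comp_assoc, ← Category.assoc (αₗ _ _ _).hom, ← h,
    MonoidalLeftAction.inv_hom_actionHomLeft_assoc]

end HomObjects

/-! ### The enriched Yoneda lemma for polynomial functors -/

section Yoneda

variable {M : Type u₀} [Category.{v₀} M] [MonoidalCategory M]
variable {C : Type u₁} [Category.{v₁} C] [MonoidalLeftAction M C] [ClosedAction M C]
variable {D : Type u₂} [Category.{v₂} D] [MonoidalLeftAction M D] [ClosedAction M D]

namespace VFunctor

/-- The effect `[Y, Z] ⟶ [F Y, F Z]` of an `M`-functor on hom-objects, as a morphism of `M` rather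
than of its monoidal opposite. -/
def homMap (F : VFunctor Mᴹᵒᵖ D C) (Y Z : D) :
    homObj M Y Z ⟶ homObj M (F.obj Y) (F.obj Z) :=
  (F.map Y Z).unmop

/-- The action `[Y, Z] • F Y ⟶ F Z` of an `M`-functor `F`, the transpose of its effect
`[Y, Z] ⟶ [F Y, F Z]` on hom-objects. -/
def act (F : VFunctor Mᴹᵒᵖ D C) (Y Z : D) : homObj M Y Z ⊙ₗ F.obj Y ⟶ F.obj Z :=
  F.homMap Y Z ⊵ₗ F.obj Y ≫ homEval M (F.obj Y) (F.obj Z)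

lemma act_unit (F : VFunctor Mᴹᵒᵖ D C) (Y : D) :
    homUnit M Y ⊵ₗ F.obj Y ≫ F.act Y Y = (λₗ (F.obj Y)).hom := by
  have h : homUnit M Y ≫ F.homMap Y Y = homUnit M (F.obj Y) :=
    congrArg Quiver.Hom.unmop (F.map_id Y)
  rw [act, ← MonoidalLeftAction.comp_actionHomLeft_assoc, h, homUnit_eval]

lemma act_comp (F : VFunctor Mᴹᵒᵖ D C) (W Y Z : D) :
    homComp M W Y Z ⊵ₗ F.obj W ≫ F.act W Z =
      (αₗ _ _ _).hom ≫ homObj M Y Z ⊴ₗ F.act W Y ≫ F.act Y Z := by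
  have h : homComp M W Y Z ≫ F.homMap W Z =
      (F.homMap Y Z ⊗ₘ F.homMap W Y) ≫ homComp M _ _ _ :=
    congrArg Quiver.Hom.unmop (F.map_comp W Y Z)
  simp only [act]
  rw [← MonoidalLeftAction.comp_actionHomLeft_assoc, h,
    MonoidalLeftAction.comp_actionHomLeft_assoc, homComp_eval, tensor_act]
  simp only [Category.assoc, Iso.inv_hom_id_assoc, MonoidalLeftAction.actionHomRight_comp]
  rw [← MonoidalLeftAction.action_exchange_assoc]

end VFunctor

lemma VNatTrans.ext_app {F G : VFunctor Mᴹᵒᵖ D C} {σ τ : F ⟶ G}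
    (h : ∀ Y, VNatTrans.app σ Y = VNatTrans.app τ Y) : σ = τ := by
  obtain ⟨a, _⟩ := σ
  obtain ⟨b, _⟩ := τ
  obtain rfl : a = b := funext h
  rfl

lemma VNatTrans.comp_app {F G H : VFunctor Mᴹᵒᵖ D C} (σ : F ⟶ G) (τ : G ⟶ H) (Y : D) :
    VNatTrans.app (σ ≫ τ) Y = VNatTrans.app σ Y ≫ VNatTrans.app τ Y :=
  rfl

lemma VNatTrans.id_app (F : VFunctor Mᴹᵒᵖ D C) (Y : D) : VNatTrans.app (𝟙 F) Y = 𝟙 (F.obj Y) :=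
  rfl

/-- A naturality square of hom-objects `[Y, Z] ⟶ [F Y, G Z]` commutes if and only if its transpose,
a square of actions `[Y, Z] • F Y ⟶ G Z` in `C`, does. -/
lemma naturality_iff_act (F G : VFunctor Mᴹᵒᵖ D C) {Y Z : D} (a : F.obj Y ⟶ G.obj Y)
    (b : F.obj Z ⟶ G.obj Z) :
    F.map Y Z ≫ eHomWhiskerLeft Mᴹᵒᵖ (F.obj Y) b =
        G.map Y Z ≫ eHomWhiskerRight Mᴹᵒᵖ a (G.obj Z) ↔
      F.act Y Z ≫ b = homObj M Y Z ⊴ₗ a ≫ G.act Y Z := by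
  have hF : (F.homMap Y Z ≫ (eHomWhiskerLeft Mᴹᵒᵖ (F.obj Y) b).unmop) ⊵ₗ F.obj Y ≫
      homEval M _ _ = F.act Y Z ≫ b := by
    rw [MonoidalLeftAction.comp_actionHomLeft_assoc, eHomWhiskerLeft_eval, VFunctor.act,
      Category.assoc]
  have hG : (G.homMap Y Z ≫ (eHomWhiskerRight Mᴹᵒᵖ a (G.obj Z)).unmop) ⊵ₗ F.obj Y ≫
      homEval M _ _ = homObj M Y Z ⊴ₗ a ≫ G.act Y Z := by
    rw [MonoidalLeftAction.comp_actionHomLeft_assoc, eHomWhiskerRight_eval, VFunctor.act]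
    exact (MonoidalLeftAction.action_exchange_assoc _ _ _).symm
  rw [← hF, ← hG]
  refine ⟨fun h => ?_, fun h => ?_⟩
  · exact congrArg (fun t => t.unmop ⊵ₗ F.obj Y ≫ homEval M _ _) h
  · exact MonoidalOpposite.hom_ext (homObj_hom_ext h)

lemma VNatTrans.act_app {F G : VFunctor Mᴹᵒᵖ D C} (τ : F ⟶ G) (Y Z : D) :
    F.act Y Z ≫ VNatTrans.app τ Z = homObj M Y Z ⊴ₗ VNatTrans.app τ Y ≫ G.act Y Z :=
  (naturality_iff_act F G _ _).1 (VNatTrans.naturality τ Y Z)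

variable [HasCoproducts.{w} C] [PreservesCoproductsInObject.{w} M C]

section Summands

variable {I : Type w} (X : I → C) (X' : I → D)

variable (M) in
/-- The summand inclusion `polyι` of a polynomial functor, with the value of the functor as its
declared target: `(polyFunctor X X').obj Y` agrees with `polyObj X X' Y` only after unfolding
`polyFunctor`, which rewriting does not see through. -/
def polyIncl (Y : D) (i : I) : homObj M (X' i) Y ⊙ₗ X i ⟶ (polyFunctor (M := M) X X').obj Y :=
  polyι M X X' Y i

/-- A morphism out of a value of a polynomial functor, given on summands. -/
def polyDesc (Y : D) {Z : C} (f : ∀ i, homObj M (X' i) Y ⊙ₗ X i ⟶ Z) :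
    (polyFunctor (M := M) X X').obj Y ⟶ Z :=
  Sigma.desc f

lemma polyIncl_desc (Y : D) {Z : C} (f : ∀ i, homObj M (X' i) Y ⊙ₗ X i ⟶ Z) (i : I) :
    polyIncl M X X' Y i ≫ polyDesc X X' Y f = f i :=
  Sigma.ι_desc _ _

variable {X X'} in
lemma poly_hom_ext {Y : D} {Z : C} {f g : (polyFunctor (M := M) X X').obj Y ⟶ Z}
    (h : ∀ i, polyIncl M X X' Y i ≫ f = polyIncl M X X' Y i ≫ g) : f = g :=
  Sigma.hom_ext _ _ h

variable {X X'} in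
lemma act_poly_hom_ext {P : M} {Y : D} {Z : C}
    {f g : P ⊙ₗ (polyFunctor (M := M) X X').obj Y ⟶ Z}
    (h : ∀ i, P ⊴ₗ polyIncl M X X' Y i ≫ f = P ⊴ₗ polyIncl M X X' Y i ≫ g) : f = g :=
  actPoly_hom_ext h

lemma polyIncl_act (Y Z : D) (i : I) :
    homObj M Y Z ⊴ₗ polyIncl M X X' Y i ≫ (polyFunctor (M := M) X X').act Y Z =
      (αₗ _ _ _).inv ≫ homComp M (X' i) Y Z ⊵ₗ X i ≫ polyIncl M X X' Z i := by
  have h : (polyFunctor (M := M) X X').act Y Z = polyAct M X X' Y Z :=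
    tensorHomEquiv_act_homEval _
  rw [h]
  exact polyι_act X X' Y Z i

variable (M) in
/-- The generic element `X i ⟶ ∑ k, [X' k, X' i] • X k` of a polynomial functor, given by the
unit `1 ⟶ [X' i, X' i]`. -/
def polyUnit (i : I) : X i ⟶ (polyFunctor (M := M) X X').obj (X' i) :=
  (λₗ (X i)).inv ≫ homUnit M (X' i) ⊵ₗ X i ≫ polyIncl M X X' (X' i) i

/-- The generic elements generate: the inclusion of a summand is obtained from the generic
element of that summand by the action of the functor. -/
lemma polyUnit_act (i : I) (Z : D) :
    homObj M (X' i) Z ⊴ₗ polyUnit M X X' i ≫ (polyFunctor (M := M) X X').act (X' i) Z =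
      polyIncl M X X' Z i := by
  simp only [polyUnit, MonoidalLeftAction.actionHomRight_comp, Category.assoc, polyIncl_act]
  have h := congrArg (· ⊵ₗ X i) (homUnit_comp (M := M) (X' i) Z)
  simp only [MonoidalLeftAction.comp_actionHomLeft, MonoidalLeftAction.whiskerLeft_actionHomLeft,
    MonoidalLeftAction.rightUnitor_actionHom, Category.assoc, cancel_epi] at h
  rw [reassoc_of% h, MonoidalLeftAction.actionHomRight_inv_hom_assoc]

end Summands

variable {I : Type w} {X : I → C} {X' : I → D} (F : VFunctor Mᴹᵒᵖ D C)

/-- The `M`-natural transformation out of a polynomial functor that is determined by the images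
`X i ⟶ F (X' i)` of the generic elements. -/
def polyNatTrans (f : ∀ i, X i ⟶ F.obj (X' i)) : polyFunctor (M := M) X X' ⟶ F where
  app Z := polyDesc X X' Z fun i => homObj M (X' i) Z ⊴ₗ f i ≫ F.act (X' i) Z
  naturality Y Z := by
    rw [naturality_iff_act]
    refine act_poly_hom_ext fun i => ?_
    have h := congrArg (homObj M Y Z ⊴ₗ ·) (polyIncl_desc X X' Y
      (fun i => homObj M (X' i) Y ⊴ₗ f i ≫ F.act (X' i) Y) i)
    simp only [MonoidalLeftAction.actionHomRight_comp] at h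
    rw [reassoc_of% h, reassoc_of% (polyIncl_act X X' Y Z i), polyIncl_desc,
      ← MonoidalLeftAction.action_exchange_assoc, VFunctor.act_comp]
    simp

lemma polyIncl_natTrans (f : ∀ i, X i ⟶ F.obj (X' i)) (Z : D) (i : I) :
    polyIncl M X X' Z i ≫ VNatTrans.app (polyNatTrans F f) Z =
      homObj M (X' i) Z ⊴ₗ f i ≫ F.act (X' i) Z :=
  polyIncl_desc ..

/-- The existence half of the enriched Yoneda lemma: the images of the generic elements can be
prescribed. -/
lemma polyUnit_natTrans (f : ∀ i, X i ⟶ F.obj (X' i)) (i : I) :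
    polyUnit M X X' i ≫ VNatTrans.app (polyNatTrans F f) (X' i) = f i := by
  simp only [polyUnit, Category.assoc, polyIncl_natTrans]
  rw [← MonoidalLeftAction.action_exchange_assoc, VFunctor.act_unit]
  simp

variable {F}

/-- The uniqueness half of the enriched Yoneda lemma: an `M`-natural transformation out of a
polynomial functor is determined by the images of the generic elements. -/
lemma polyNatTrans_ext {σ τ : polyFunctor (M := M) X X' ⟶ F}
    (h : ∀ i, polyUnit M X X' i ≫ VNatTrans.app σ (X' i) =
      polyUnit M X X' i ≫ VNatTrans.app τ (X' i)) : σ = τ := by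
  refine VNatTrans.ext_app fun Z => poly_hom_ext fun i => ?_
  -- By naturality, the component of `ρ` on a summand is the action of `F` on the image of the
  -- generic element.
  have key (ρ : polyFunctor (M := M) X X' ⟶ F) : polyIncl M X X' Z i ≫ VNatTrans.app ρ Z =
      homObj M (X' i) Z ⊴ₗ (polyUnit M X X' i ≫ VNatTrans.app ρ (X' i)) ≫ F.act (X' i) Z := by
    rw [← polyUnit_act, Category.assoc, VNatTrans.act_app,
      MonoidalLeftAction.actionHomRight_comp, Category.assoc]
  rw [key, key, h]

end Yoneda

/-! ### Transposes of matrix actions -/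

section Transpose

variable {M : Type u₀} [Category.{v₀} M] [MonoidalCategory M]
variable {D : Type u₂} [Category.{v₂} D] [MonoidalLeftAction M D] [ClosedAction M D]
variable [HasCoproducts.{w} D]
variable {I J K : Type w}

/-- The transposes `A i j ⟶ [Y' j, W]` of the components of a morphism `∑ j, A i j • Y' j ⟶ W`. -/
def matTranspose {A : I → J → M} {Y' : J → D} {i : I} {W : D} (b : matAct A Y' i ⟶ W) (j : J) :
    A i j ⟶ homObj M (Y' j) W :=
  tensorHomEquiv _ _ _ (actι A Y' i j ≫ b)

lemma matTranspose_eval {A : I → J → M} {Y' : J → D} {i : I} {W : D} (b : matAct A Y' i ⟶ W)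
    (j : J) : matTranspose b j ⊵ₗ Y' j ≫ homEval M _ _ = actι A Y' i j ≫ b :=
  tensorHomEquiv_act_homEval _

lemma matTranspose_mapLeft {A B : I → J → M} (φ : ∀ i j, A i j ⟶ B i j) {Y' : J → D} {i : I}
    {W : D} (b : matAct B Y' i ⟶ W) (j : J) :
    matTranspose (actMapLeft φ Y' i ≫ b) j = φ i j ≫ matTranspose b j := by
  refine homObj_hom_ext ?_
  rw [MonoidalLeftAction.comp_actionHomLeft_assoc, matTranspose_eval, matTranspose_eval,
    actι_mapLeft_assoc, Category.assoc]

variable (M) in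
/-- The evaluation `∑ j, [Y' j, X' i] • Y' j ⟶ X' i`. -/
def matEval (X' : I → D) (Y' : J → D) (i : I) :
    matAct (fun i j => homObj M (Y' j) (X' i)) Y' i ⟶ X' i :=
  actDesc _ _ i fun j => homEval M (Y' j) (X' i)

lemma matTranspose_matEval (X' : I → D) (Y' : J → D) (i : I) (j : J) :
    matTranspose (matEval M X' Y' i) j = 𝟙 (homObj M (Y' j) (X' i)) := by
  refine homObj_hom_ext ?_
  rw [matTranspose_eval]
  simp [matEval]

lemma actMapLeft_matTranspose_eval {A : I → J → M} {X' : I → D} {Y' : J → D}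
    (b : ∀ i, matAct A Y' i ⟶ X' i) (i : I) :
    actMapLeft (fun i => matTranspose (b i)) Y' i ≫ matEval M X' Y' i = b i := by
  refine act_hom_ext fun j => ?_
  rw [actι_mapLeft_assoc, Category.assoc, matEval, actι_desc, matTranspose_eval]

variable [DistributiveMonoidal.{w} M] [PreservesCoproductsInScalar.{w} M D]

lemma unitToIdMatrix_matTranspose (X' : I → D) (i : I) :
    unitToIdMatrix rfl ≫ matTranspose (actIdDesc M X' i) i = homUnit M (X' i) := by
  refine homObj_hom_ext ?_
  rw [MonoidalLeftAction.comp_actionHomLeft_assoc, matTranspose_eval, homUnit_eval,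
    unit_actIdDesc]
  simp

/-- The transpose of a composite of backward parts is computed by the composition of
hom-objects. -/
lemma mulι_matTranspose {A : I → J → M} {B : J → K → M} {Y' : J → D} {Z' : K → D} {i : I} {W : D}
    (b : matAct A Y' i ⟶ W) (c : ∀ j, matAct B Z' j ⟶ Y' j) (j : J) (k : K) :
    mulι A B i j k ≫ matTranspose (actUnmul A B Z' i ≫ actMapRight A c i ≫ b) k =
      (matTranspose b j ⊗ₘ matTranspose (c j) k) ≫ homComp M (Z' k) (Y' j) W := by
  refine homObj_hom_ext ?_
  rw [MonoidalLeftAction.comp_actionHomLeft_assoc, matTranspose_eval, mulι_actUnmul_assoc,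
    MonoidalLeftAction.comp_actionHomLeft_assoc, homComp_eval, tensor_act]
  simp only [Category.assoc, Iso.inv_hom_id_assoc, actι_mapRight_assoc]
  have h := congrArg (A i j ⊴ₗ ·) (matTranspose_eval (c j) k)
  simp only [MonoidalLeftAction.actionHomRight_comp] at h
  rw [← MonoidalLeftAction.action_exchange_assoc, matTranspose_eval, reassoc_of% h]

end Transpose

/-! ### Optics as families of elements of a polynomial functor -/

section Points

variable {M : Type u₀} [Category.{v₀} M] [MonoidalCategory M]
variable {C : Type u₁} [Category.{v₁} C] [MonoidalLeftAction M C] [ClosedAction M C]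
variable {D : Type u₂} [Category.{v₂} D] [MonoidalLeftAction M D] [ClosedAction M D]
variable [HasCoproducts.{w} C] [HasCoproducts.{w} D] [PreservesCoproductsInObject.{w} M C]

section Matrices

variable {I J K : Type w}

/-- The morphism `∑ j, A i j • Y j ⟶ ∑ j, [Y' j, W] • Y j` induced by the transposes of a morphism
`∑ j, A i j • Y' j ⟶ W`. -/
def actToPoly {A : I → J → M} (Y : J → C) {Y' : J → D} {i : I} {W : D} (b : matAct A Y' i ⟶ W) :
    matAct A Y i ⟶ (polyFunctor (M := M) Y Y').obj W :=
  actDesc _ _ i fun j => matTranspose b j ⊵ₗ Y j ≫ polyIncl M Y Y' W j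

lemma actι_toPoly {A : I → J → M} (Y : J → C) {Y' : J → D} {i : I} {W : D}
    (b : matAct A Y' i ⟶ W) (j : J) : actι A Y i j ≫ actToPoly Y b =
      matTranspose b j ⊵ₗ Y j ≫ polyIncl M Y Y' W j :=
  actι_desc ..

lemma actι_toPoly_assoc {A : I → J → M} (Y : J → C) {Y' : J → D} {i : I} {W : D}
    (b : matAct A Y' i ⟶ W) (j : J) {T : C} (t : (polyFunctor (M := M) Y Y').obj W ⟶ T) :
    actι A Y i j ≫ actToPoly Y b ≫ t =
      matTranspose b j ⊵ₗ Y j ≫ polyIncl M Y Y' W j ≫ t := by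
  rw [← Category.assoc, actι_toPoly, Category.assoc]

lemma actToPoly_mapLeft {A B : I → J → M} (φ : ∀ i j, A i j ⟶ B i j) (Y : J → C) {Y' : J → D}
    {i : I} {W : D} (b : matAct B Y' i ⟶ W) :
    actToPoly Y (actMapLeft φ Y' i ≫ b) = actMapLeft φ Y i ≫ actToPoly Y b := by
  refine act_hom_ext fun j => ?_
  rw [actι_toPoly, actι_mapLeft_assoc, Category.assoc, actι_toPoly, matTranspose_mapLeft,
    MonoidalLeftAction.comp_actionHomLeft_assoc]

/-- The comparison `actToPoly` is the identity when the matrix is `[Y' j, X' i]` and the morphism is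
evaluation. The intermediate object is given explicitly because `(polyFunctor Y Y').obj (X' i)` and
the action of this matrix on `Y` are the same only by definitional unfolding. -/
lemma comp_actToPoly_matEval (X' : I → D) (Y : J → C) (Y' : J → D) (i : I) {Z : C}
    (f : Z ⟶ (polyFunctor (M := M) Y Y').obj (X' i)) :
    CategoryStruct.comp (Y := matAct (fun i j => homObj M (Y' j) (X' i)) Y i) f
      (actToPoly Y (matEval M X' Y' i)) = f := by
  have h : actToPoly Y (matEval M X' Y' i) =
      𝟙 (matAct (fun i j => homObj M (Y' j) (X' i)) Y i) := by
    refine act_hom_ext fun j => ?_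
    rw [actι_toPoly, matTranspose_matEval, MonoidalLeftAction.id_actionHomLeft, Category.id_comp]
    exact (Category.comp_id _).symm
  rw [h]
  exact Category.comp_id _

variable [DistributiveMonoidal.{w} M] [PreservesCoproductsInScalar.{w} M D]

lemma actIdι_toPoly (X : I → C) (X' : I → D) (i : I) :
    actIdι M X i ≫ actToPoly X (actIdDesc M X' i) = polyUnit M X X' i := by
  rw [actIdι, polyUnit, Category.assoc, Category.assoc, actι_toPoly,
    ← MonoidalLeftAction.comp_actionHomLeft_assoc, unitToIdMatrix_matTranspose]

/-- Compatibility of `actToPoly` with composition: the left-hand side is the family of the composite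
of two optics (without the forward part of the first), and the right-hand side applies to the family
of the first optic the `M`-natural transformation that corresponds to the second. -/
lemma actMul_toPoly {A : I → J → M} {B : J → K → M} {Y : J → C} {Y' : J → D} {Z : K → C}
    {Z' : K → D} {i : I} {W : D} (b : matAct A Y' i ⟶ W) (f : ∀ j, Y j ⟶ matAct B Z j)
    (c : ∀ j, matAct B Z' j ⟶ Y' j) :
    actMapRight A f i ≫ actMul A B Z i ≫
        actToPoly Z (actUnmul A B Z' i ≫ actMapRight A c i ≫ b) =
      actToPoly Y b ≫ VNatTrans.app
        (polyNatTrans (polyFunctor Z Z') fun j => f j ≫ actToPoly Z (c j)) W := by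
  refine act_hom_ext fun j => ?_
  rw [actι_mapRight_assoc, Category.assoc, actι_toPoly_assoc, polyIncl_natTrans,
    MonoidalLeftAction.actionHomRight_comp_assoc,
    ← MonoidalLeftAction.action_exchange_assoc]
  congr 1
  refine actAct_hom_ext fun k => ?_
  rw [actι_actMul_assoc, Category.assoc, Category.assoc, actι_toPoly,
    ← MonoidalLeftAction.comp_actionHomLeft_assoc, mulι_matTranspose,
    MonoidalLeftAction.action_exchange_assoc,
    ← MonoidalLeftAction.actionHomRight_comp_assoc, actι_toPoly,
    MonoidalLeftAction.actionHomRight_comp_assoc, polyIncl_act,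
    MonoidalLeftAction.comp_actionHomLeft_assoc, tensor_act]
  simp only [Category.assoc, Iso.inv_hom_id_assoc]
  rw [← MonoidalLeftAction.action_exchange_assoc]

end Matrices

namespace PreOptic

variable {X Y Z : IndexedOptic.{w} M C D}

/-- The family `X i ⟶ ∑ j, [Y' j, X' i] • Y j` that an optic amounts to: its forward part followed
by the comparison that the transposes of its backward part induce. -/
def points (p : PreOptic X Y) (i : X.index) :
    X.fst i ⟶ (polyFunctor (M := M) Y.fst Y.snd).obj (X.snd i) :=
  p.fwd i ≫ actToPoly Y.fst (p.bwd i)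

/-- The family of an optic does not depend on the representative in the coend. -/
lemma Slide.points_eq {p q : PreOptic X Y} (h : Slide p q) : p.points = q.points := by
  obtain ⟨φ, h₁, h₂⟩ := h
  funext i
  rw [points, points, h₁, h₂, Category.assoc, actToPoly_mapLeft]

/-- The representative of an optic that has a given family as its forward part, the matrix
`[Y' j, X' i]` as its residual, and evaluation as its backward part. -/
def ofPoints (f : ∀ i, X.fst i ⟶ (polyFunctor (M := M) Y.fst Y.snd).obj (X.snd i)) :
    PreOptic X Y where
  res i j := homObj M (Y.snd j) (X.snd i)
  fwd := f
  bwd := matEval M X.snd Y.snd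

lemma points_ofPoints (f : ∀ i, X.fst i ⟶ (polyFunctor (M := M) Y.fst Y.snd).obj (X.snd i)) :
    (ofPoints f).points = f :=
  funext fun i => comp_actToPoly_matEval X.snd Y.fst Y.snd i (f i)

/-- Every optic slides along the transposes of its backward part to the representative with residual
`[Y' j, X' i]`. -/
lemma slide_ofPoints (p : PreOptic X Y) : Slide p (ofPoints p.points) :=
  ⟨fun i => matTranspose (p.bwd i), fun _ => rfl,
    fun i => (actMapLeft_matTranspose_eval p.bwd i).symm⟩

variable [DistributiveMonoidal.{w} M] [PreservesCoproductsInScalar.{w} M D]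

lemma points_id (X : IndexedOptic.{w} M C D) : (id X).points = polyUnit M X.fst X.snd :=
  funext fun i => actIdι_toPoly X.fst X.snd i

/-- The family of a composite of optics: the `M`-natural transformation that corresponds to the
second optic is applied to the family of the first. -/
lemma points_comp (p : PreOptic X Y) (q : PreOptic Y Z) (i : X.index) :
    (p.comp q).points i =
      p.points i ≫ VNatTrans.app (polyNatTrans (polyFunctor Z.fst Z.snd) q.points) (X.snd i) := by
  simp only [points, comp, Category.assoc, actMul_toPoly]
  rfl

end PreOptic

end Points

/-! ### The functor from optics to polynomial functors -/

section Equivalence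

variable (M : Type u₀) [Category.{v₀} M] [MonoidalCategory M] [DistributiveMonoidal.{w} M]
variable (C : Type u₁) [Category.{v₁} C] [HasCoproducts.{w} C] [MonoidalLeftAction M C]
variable (D : Type u₂) [Category.{v₂} D] [HasCoproducts.{w} D] [MonoidalLeftAction M D]
variable [PreservesCoproductsInScalar.{w} M D] [PreservesCoproductsInObject.{w} M C]
variable [ClosedAction M C] [ClosedAction M D]

/-- The functor that sends the family `(X i, X' i)` to the polynomial `M`-functor
`Y ↦ ∑ i, [X' i, Y] • X i`. -/
def opticToPoly : IndexedOptic.{w} M C D ⥤ VFunctor Mᴹᵒᵖ D C where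
  obj P := polyFunctor (M := M) P.fst P.snd
  map {P Q} f := polyNatTrans (polyFunctor Q.fst Q.snd)
    (Quot.lift PreOptic.points (fun _ _ h => h.points_eq) f)
  map_id P := polyNatTrans_ext fun i => by
    rw [polyUnit_natTrans, VNatTrans.id_app, Category.comp_id]
    exact congrFun (PreOptic.points_id P) i
  map_comp {P Q R} f g := polyNatTrans_ext fun i => by
    induction f using Quot.ind with | _ p
    induction g using Quot.ind with | _ q
    rw [polyUnit_natTrans, VNatTrans.comp_app, ← Category.assoc, polyUnit_natTrans]
    exact PreOptic.points_comp p q i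

instance opticToPoly_faithful : (opticToPoly.{w} M C D).Faithful where
  map_injective {P Q} f g h := by
    induction f using Quot.ind with | _ p
    induction g using Quot.ind with | _ q
    have e : p.points = q.points := by
      funext i
      have h' := congrArg (fun τ => polyUnit M P.fst P.snd i ≫ VNatTrans.app τ (P.snd i)) h
      exact ((polyUnit_natTrans _ _ i).symm.trans h').trans (polyUnit_natTrans _ _ i)
    calc Quot.mk _ p = Quot.mk _ (PreOptic.ofPoints p.points) := Quot.sound p.slide_ofPoints
      _ = Quot.mk _ (PreOptic.ofPoints q.points) := by rw [e]
      _ = Quot.mk _ q := (Quot.sound q.slide_ofPoints).symm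

instance opticToPoly_full : (opticToPoly.{w} M C D).Full where
  map_surjective {P _} τ :=
    ⟨Quot.mk _ (PreOptic.ofPoints fun i => polyUnit M P.fst P.snd i ≫ VNatTrans.app τ (P.snd i)),
      polyNatTrans_ext fun i => (polyUnit_natTrans _ _ i).trans
        (congrFun (PreOptic.points_ofPoints _) i)⟩

end Equivalence

end IndexedOptics

end

theorem mainTheorem1
    {M : Type u₀} [Category.{v₀} M] [MonoidalCategory M]
    [IndexedOptics.DistributiveMonoidal.{w} M]
    {C : Type u₁} [Category.{v₁} C] [HasCoproducts.{w} C] [MonoidalLeftAction M C]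
    {D : Type u₂} [Category.{v₂} D] [HasCoproducts.{w} D] [MonoidalLeftAction M D]
    [IndexedOptics.PreservesCoproductsInScalar.{w} M C]
    [IndexedOptics.PreservesCoproductsInScalar.{w} M D]
    [IndexedOptics.PreservesCoproductsInObject.{w} M C]
    [IndexedOptics.ClosedAction M C] [IndexedOptics.ClosedAction M D] :
    ∃ e : IndexedOptics.IndexedOptic.{w} M C D ≌ IndexedOptics.PolynomialFunctor.{w} M C D,
      ∀ P : IndexedOptics.IndexedOptic.{w} M C D,
        Nonempty ((e.functor.obj P).obj ≅
          IndexedOptics.polyFunctor (M := M) P.fst P.snd) := by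
  let Φ : IndexedOptics.IndexedOptic.{w} M C D ⥤ IndexedOptics.PolynomialFunctor.{w} M C D :=
    (IndexedOptics.isPolynomial.{w} M C D).lift (IndexedOptics.opticToPoly.{w} M C D)
      fun P => ⟨P.index, P.fst, P.snd, ⟨Iso.refl _⟩⟩
  have hι : Φ ⋙ (IndexedOptics.isPolynomial.{w} M C D).ι ≅ IndexedOptics.opticToPoly.{w} M C D :=
    Iso.refl _
  have : Φ.Full := Functor.Full.of_comp_faithful_iso hι
  have : Φ.Faithful := Functor.Faithful.of_comp_iso hι
  have : Φ.EssSurj := ⟨fun ⟨F, I, X, X', ⟨i⟩⟩ =>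
    ⟨⟨I, X, X'⟩, ⟨ObjectProperty.isoMk _ i.symm⟩⟩⟩
  have : Φ.IsEquivalence := {}
  exact ⟨Φ.asEquivalence, fun P => ⟨Iso.refl _⟩⟩
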